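/- A permutation $\pi=\pi_1\cdots\pi_n$ contains a permutation $\rho=\rho_1\cdots\rho_k$ if there are indices $i_1<\cdots<i_k$ such that, for all $r,s\in\{1,\dots,k\}$, $\pi_{i_r}<\pi_{i_s}$ if and only if $\rho_r<\rho_s$; otherwise $\pi$ avoids $\rho$. For integers $a\ge 1$, $b\ge 0$ with $a+b\ge 2$, let $\Pi(a,b)$ be the set of permutations of $\{1,\dots,a+b\}$ obtained by writing the elements other than $a$ in increasing order and inserting $a$ in any position except the one that gives the identity. Let $\delta_3=321$, and let $\mathrm{Av}_n(\Pi(a,b),\delta_3)$ be the set of permutations of size $n$ that avoid $\delta_3$ and every element of $\Pi(a,b)$. **Theorem.** Let $a\ge 1$ and $b\ge 0$ be integers with $a+b\ge 3$. Then there is a polynomial $p\in\mathbb{Q}[x]$ such that $\#\mathrm{Av}_n(\Pi(a,b),\delta_3)=p(n)$ for all sufficiently large integers $n$, and any such polynomial has leading term $C_{a+b-2}\binom{x}{a+b-2}$, that is, $$p(x)=C_{a+b-2}\binom{x}{a+b-2}+r(x)\quad\text{with } r\in\mathbb{Q}[x],\ r=0 \text{ or } \deg r<a+b-2,$$ where $C_k=\frac{1}{k+1}\binom{2k}{k}$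 is the $k$-th Catalan number and $\binom{x}{k}=\frac{x(x-1)\cdots(x-k+1)}{k!}$. -/

import Mathlib

namespace PermPattern

/-- A pattern is a permutation of some finite size `k`; the one-line notation of `ρ` is
`ρ 0, ρ 1, …, ρ (k-1)`, with both positions and values numbered from `0`. -/
abbrev Pattern : Type := Σ k : ℕ, Equiv.Perm (Fin k)

/-- `π` contains `ρ`: some subsequence `π (f 0), …, π (f (k-1))` of `π`, read from left to right,
is in the same relative order as `ρ`. -/
def Contains {n k : ℕ} (π : Equiv.Perm (Fin n)) (ρ : Equiv.Perm (Fin k)) : Prop :=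
  ∃ f : Fin k ↪o Fin n, ∀ i j : Fin k, π (f i) < π (f j) ↔ ρ i < ρ j

/-- The set of permutations of size `n` that avoid every pattern in `P`. -/
def Av (n : ℕ) (P : Set Pattern) : Set (Equiv.Perm (Fin n)) :=
  {π | ∀ ρ ∈ P, ¬ Contains π ρ.2}

/-- The decreasing permutation of size `k`. -/
def decreasing (k : ℕ) : Pattern := ⟨k, Fin.revPerm⟩

/-- The partial shuffle `Π(a,b)`: the non-identity permutations of size `a + b` in which the
elements other than `a` occur in increasing order. As values are numbered from `0` here, the
element `a` is the value `v` with `v + 1 = a`. -/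
def partialShuffle (a b : ℕ) : Set Pattern :=
  Sigma.mk (a + b) '' {ρ : Equiv.Perm (Fin (a + b)) | ρ ≠ 1 ∧
    ∀ i j : Fin (a + b), (ρ i : ℕ) + 1 ≠ a → (ρ j : ℕ) + 1 ≠ a → i < j → ρ i < ρ j}

/-- The polynomial `p` counts the members of size `n` of the class avoiding `P`, for all
sufficiently large `n`. -/
def EventuallyCounts (p : Polynomial ℚ) (P : Set Pattern) : Prop :=
  ∀ᶠ n : ℕ in Filter.atTop, ((Av n P).ncard : ℚ) = p.eval (n : ℚ)

/-- The binomial coefficient `X(X-1)⋯(X-k+1)/k!` as a polynomial in the upper entry. -/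
noncomputable def binomPoly (k : ℕ) : Polynomial ℚ :=
  Polynomial.C ((k.factorial : ℚ)⁻¹) * descPochhammer ℚ k

/-- The leading term of `p` in the basis of binomial coefficient polynomials is
`c * binomPoly k`: `c ≠ 0` and `p` is `c * binomPoly k` plus a polynomial of degree below `k`. -/
def HasLeadingTerm (p : Polynomial ℚ) (c : ℚ) (k : ℕ) : Prop :=
  c ≠ 0 ∧ (p - Polynomial.C c * binomPoly k).degree < (k : WithBot ℕ)

end PermPattern

/-! ### Permutations as words of ascending runs -/

namespace PermPattern

open List

/-! Write under each value `v` of `π` the index, counted from `0`, of the ascending run of `π` that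
contains `v`. The resulting word determines `π`, which is its stable sort (`SortsTo`). The words
that arise are those in which, for consecutive run indices, some `i + 1` precedes some `i`
(`Proper`). With `c = a - 1`, avoidance becomes a condition on subwords of lengths `3` and `c + b +
1` (`Good`, `ncard_Av_eq`).

Two facts make the count polynomial. A good proper word has at most `c + b` distinct letters
(`Good.lt_of_proper`). And all occurrences of a frequent letter except the first `c + 1` and the
last `b + 1` are consecutive (`Good.exists_run`), so lengthening that run by one is a bijection, and
the number of words with letter counts `g` depends only on `g` truncated at a constant
(`ncard_goodWords_min`). The sum of such a function over vectors of `d + 1` entries with sum `n` is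
eventually a polynomial of degree at most `d`, whose coefficient in degree `d` is the value at an
all-large vector divided by `d!` (`exists_poly_sum_truncated`). Only `d = m = c + b - 1` contributes
to degree `m`.

It remains to count the good proper words in which each of `0, …, m` occurs `κ` times, `κ` large.
For `c, b ≥ 1` they are the products `X B Y A Z` with `B` and `A` long sorted blocks on the letters
`≥ c` and `< c`, and `X`, `Y`, `Z` short (`Shape`). Cutting a Dyck word of semilength `m` at its
`c`-th up step and its `c`-th down step gives three pieces that encode `X`, `Y`, `Z`, whence the
Catalan number. If `c = 0` only `B Z` remains, and `b = 0` follows by reverse complement. -/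

/-- A word avoids strictly decreasing triples, and a subword of length `c + b + 1` is weakly
increasing as soon as it is so after removal of its entry number `c`. -/
def Good (c b : ℕ) (W : List ℕ) : Prop :=
  (∀ x y z, [x, y, z] <+ W → y < x → ¬ z < y) ∧
  ∀ xs v ys, xs ++ v :: ys <+ W → xs.length = c → ys.length = b →
    (xs ++ ys).Pairwise (· ≤ ·) → (xs ++ v :: ys).Pairwise (· ≤ ·)

/-- The letters of the word are at most `d`, and each `i + 1` with `i < d` has some occurrence
before some occurrence of `i`. -/
def Proper (d : ℕ) (W : List ℕ) : Prop :=
  (∀ x ∈ W, x ≤ d) ∧ ∀ i < d, [i + 1, i] <+ W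

/-- The number of descents of the sequence `p` before index `j`. -/
def desCount (p : ℕ → ℕ) : ℕ → ℕ
  | 0 => 0
  | j + 1 => desCount p j + if p (j + 1) < p j then 1 else 0

/-- Each step is a descent, which raises the count, or, adjacent entries being distinct, an ascent,
which keeps the count and raises the entry. -/
lemma desCount_lt_or (p : ℕ → ℕ) {i j : ℕ} (hij : i < j) (hp : ∀ k < j, p k ≠ p (k + 1)) :
    desCount p i < desCount p j ∨ (desCount p i = desCount p j ∧ p i < p j) := by
  induction j, hij using Nat.le_induction with
  | base =>
    have := hp i (by simp)
    simp only [Nat.succ_eq_add_one, desCount]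
    split_ifs <;> omega
  | succ j hj ih =>
    have := hp j (by simp)
    have := ih (fun k hk => hp k (by omega))
    simp only [desCount]
    split_ifs <;> omega

lemma desCount_mono (p : ℕ → ℕ) : Monotone (desCount p) :=
  monotone_nat_of_le_succ fun j => by simp [desCount]

lemma exists_desCount_eq (p : ℕ → ℕ) {i N : ℕ} (h : i < desCount p N) :
    ∃ j < N, desCount p j = i ∧ desCount p (j + 1) = i + 1 ∧ p (j + 1) < p j := by
  induction N with
  | zero => simp [desCount] at h
  | succ N ih =>
    by_cases hN : i < desCount p N
    · obtain ⟨j, hj, h'⟩ := ih hN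
      exact ⟨j, by omega, h'⟩
    · refine ⟨N, by omega, ?_⟩
      simp only [desCount] at h ⊢
      split_ifs at h ⊢ <;> omega

variable {n : ℕ}

/-- The one-line notation of a permutation, extended by `0`. -/
def oneLine (π : Equiv.Perm (Fin n)) (i : ℕ) : ℕ := if h : i < n then π ⟨i, h⟩ else 0

/-- The number of descents before the position of the value `v`. -/
def blockOf (π : Equiv.Perm (Fin n)) (v : Fin n) : ℕ := desCount (oneLine π) (π.symm v)

lemma oneLine_val (π : Equiv.Perm (Fin n)) (i : Fin n) : oneLine π i = π i := by
  simp [oneLine]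

lemma oneLine_ne (π : Equiv.Perm (Fin n)) {k : ℕ} (hk : k + 1 < n) :
    oneLine π k ≠ oneLine π (k + 1) := by
  rw [oneLine, oneLine, dif_pos hk, dif_pos (show k < n by omega)]
  intro h
  have := π.injective (Fin.val_injective h)
  simp at this

/-- Positions of values are ordered lexicographically by the letter `w v` and the value `v`. -/
def SortsTo (π : Equiv.Perm (Fin n)) (w : Fin n → ℕ) : Prop :=
  ∀ u v, π.symm u < π.symm v ↔ w u < w v ∨ (w u = w v ∧ u < v)

lemma sortsTo_of_forall {π : Equiv.Perm (Fin n)} {w : Fin n → ℕ}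
    (h : ∀ i j, i < j → w (π i) < w (π j) ∨ (w (π i) = w (π j) ∧ π i < π j)) : SortsTo π w := by
  intro u v
  rcases lt_trichotomy (π.symm u) (π.symm v) with huv | huv | huv
  · simpa [huv] using h _ _ huv
  · have : u = v := π.symm.injective huv
    subst this; simp
  · have := h _ _ huv
    simp only [Equiv.apply_symm_apply] at this
    simp only [not_lt_of_gt huv, false_iff]
    rcases this with h | ⟨h, h'⟩
    · omega
    · have := not_lt_of_gt h'
      omega

lemma sortsTo_blockOf (π : Equiv.Perm (Fin n)) : SortsTo π (blockOf π) := by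
  apply sortsTo_of_forall
  intro i j hij
  have := desCount_lt_or (oneLine π) (i := i) (j := j) hij (fun k hk => oneLine_ne π (by omega))
  simpa [blockOf, oneLine_val] using this

lemma sublist_ofFn_iff {l : List ℕ} {w : Fin n → ℕ} :
    l <+ ofFn w ↔ ∃ h : Fin l.length ↪o Fin n, ∀ i, l.get i = w (h i) := by
  rw [sublist_iff_exists_fin_orderEmbedding_get_eq]
  have e : (ofFn w).length = n := by simp
  constructor
  · rintro ⟨f, hf⟩
    refine ⟨f.trans (Fin.castOrderIso e).toOrderEmbedding, fun i => ?_⟩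
    rw [hf, get_ofFn]
    rfl
  · rintro ⟨f, hf⟩
    refine ⟨f.trans (Fin.castOrderIso e.symm).toOrderEmbedding, fun i => ?_⟩
    rw [hf]
    simp

lemma pair_sublist_ofFn_iff {x y : ℕ} {w : Fin n → ℕ} :
    [x, y] <+ ofFn w ↔ ∃ u v, u < v ∧ w u = x ∧ w v = y := by
  rw [sublist_ofFn_iff]
  constructor
  · rintro ⟨h, hh⟩
    exact ⟨h ⟨0, by simp⟩, h ⟨1, by simp⟩, by simp, (hh ⟨0, by simp⟩).symm, (hh ⟨1, by simp⟩).symm⟩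
  · rintro ⟨u, v, huv, rfl, rfl⟩
    refine ⟨OrderEmbedding.ofStrictMono ![u, v] ?_, ?_⟩
    · intro i j hij
      change Fin 2 at i j
      fin_cases i <;> fin_cases j <;> simp_all
    · intro i
      change Fin 2 at i
      fin_cases i <;> rfl

/-- Where run `i` ends and run `i + 1` begins there is a descent. Its two values, read in increasing
order, carry the letters `i + 1` and `i`. -/
lemma proper_blockOf (π : Equiv.Perm (Fin n)) : ∃ d, Proper d (ofFn (blockOf π)) := by
  refine ⟨desCount (oneLine π) (n - 1), ?_, ?_⟩
  · simp only [mem_ofFn, forall_exists_index, forall_apply_eq_imp_iff]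
    exact fun v => desCount_mono _ (by omega)
  · intro i hi
    obtain ⟨j, hj, h1, h2, h3⟩ := exists_desCount_eq _ hi
    rw [pair_sublist_ofFn_iff]
    refine ⟨π ⟨j + 1, by omega⟩, π ⟨j, by omega⟩, ?_, by simpa [blockOf], by simpa [blockOf]⟩
    have e1 := oneLine_val π ⟨j + 1, by omega⟩
    have e2 := oneLine_val π ⟨j, by omega⟩
    simp only at e1 e2
    rw [Fin.lt_def]
    omega

lemma exists_sortsTo (w : Fin n → ℕ) : ∃ π : Equiv.Perm (Fin n), SortsTo π w := by
  let f : Fin n → ℕ ×ₗ Fin n := fun v => toLex (w v, v)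
  have hf : Function.Injective f := fun u v h => (Prod.ext_iff.1 (toLex.injective h)).2
  have hs : StrictMono (f ∘ Tuple.sort f) :=
    (Tuple.monotone_sort f).strictMono_of_injective (hf.comp (Tuple.sort f).injective)
  refine ⟨Tuple.sort f, sortsTo_of_forall fun i j hij => ?_⟩
  have := hs hij
  simpa [f, Prod.Lex.toLex_lt_toLex] using this

lemma SortsTo.ext {π π' : Equiv.Perm (Fin n)} {w : Fin n → ℕ} (h : SortsTo π w)
    (h' : SortsTo π' w) : π = π' := by
  have hs : StrictMono (π.trans π'.symm) := by
    intro i j hij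
    have := (h (π i) (π j)).1 (by simpa)
    exact (h' _ _).2 this
  have : π.trans π'.symm = 1 := (Equiv.Perm.monotone_iff _).1 hs.monotone
  ext i
  have h2 := Equiv.congr_fun this i
  simp only [Equiv.trans_apply, Equiv.Perm.coe_one, id_eq] at h2
  rw [Equiv.symm_apply_eq] at h2
  rw [h2]

/-- Along the positions the letters increase weakly. Properness makes them start at `0`, rise by at
most one, and rise only at descents; within a letter the values ascend. Hence the letter is the
number of descents passed. -/
lemma SortsTo.eq_blockOf {π : Equiv.Perm (Fin n)} {w : Fin n → ℕ} (h : SortsTo π w) {d : ℕ}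
    (hd : Proper d (ofFn w)) : w = blockOf π := by
  have mono : ∀ i j, i ≤ j → w (π i) ≤ w (π j) := by
    intro i j hij
    rcases hij.eq_or_lt with rfl | hij
    · rfl
    · have := (h (π i) (π j)).1 (by simpa)
      omega
  have same : ∀ i j, w (π i) = w (π j) → i ≤ j → π i ≤ π j := by
    intro i j e hij
    rcases hij.eq_or_lt with rfl | hij
    · rfl
    · have := (h (π i) (π j)).1 (by simpa)
      exact (this.resolve_left (by omega)).2.le
  have hle : ∀ v, w v ≤ d := fun v => hd.1 _ (by simp)
  have key : ∀ i (hi : i < n), w (π ⟨i, hi⟩) = desCount (oneLine π) i := by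
    intro i
    induction i with
    | zero =>
      intro hi
      by_contra hne
      simp only [desCount] at hne
      have hlt : 0 < d := lt_of_lt_of_le (by omega) (hle (π ⟨0, hi⟩))
      obtain ⟨u, v, -, -, hv⟩ := pair_sublist_ofFn_iff.1 (hd.2 0 hlt)
      have := mono ⟨0, hi⟩ (π.symm v) (by simp [Fin.le_def])
      simp only [Equiv.apply_symm_apply] at this
      omega
    | succ i ih =>
      intro hi
      have ih := ih (by omega)
      set P : Fin n := ⟨i, by omega⟩ with hP
      set Q : Fin n := ⟨i + 1, hi⟩ with hQ
      have hPQ : P < Q := by simp [P, Q]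
      have e1 : oneLine π i = π P := oneLine_val π P
      have e2 : oneLine π (i + 1) = π Q := oneLine_val π Q
      have hPQ' := (h (π P) (π Q)).1 (by simpa)
      -- Properness supplies values `u < v` with letters `w (π P) + 1` and `w (π P)`. Then `v` lies
      -- at or before `P` and `u` at or after `Q`, so `w (π Q) ≤ w u` and `π Q ≤ u < v ≤ π P`.
      have jump : w (π P) < w (π Q) → w (π Q) = w (π P) + 1 ∧ π Q < π P := by
        intro hlt
        have := hle (π Q)
        obtain ⟨u, v, huv, hu, hv⟩ := pair_sublist_ofFn_iff.1 (hd.2 (w (π P)) (by omega))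
        have hvP : π.symm v ≤ P := by
          by_contra hc
          have := mono Q (π.symm v) (by simp only [Fin.le_def, P, Q] at hc ⊢; omega)
          simp only [Equiv.apply_symm_apply] at this
          omega
        have huQ : Q ≤ π.symm u := by
          by_contra hc
          have := mono (π.symm u) P (by simp only [Fin.le_def, P, Q] at hc ⊢; omega)
          simp only [Equiv.apply_symm_apply] at this
          omega
        have h1 := mono _ _ huQ
        have h2 := same (π.symm v) P (by simpa using hv) hvP
        simp only [Equiv.apply_symm_apply] at h1 h2
        have h3 := same Q (π.symm u) (by simp; omega) huQ
        simp only [Equiv.apply_symm_apply] at h3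
        exact ⟨by omega, lt_of_le_of_lt h3 (lt_of_lt_of_le huv h2)⟩
      rw [desCount, e1, e2]
      split_ifs with hdes
      · have := jump (by
          rcases hPQ' with h | h
          · exact h
          · have := h.2; rw [Fin.lt_def] at this; omega)
        omega
      · rcases hPQ' with h | h
        · have := (jump h).2; rw [Fin.lt_def] at this; omega
        · omega
  funext v
  have := key (π.symm v) (π.symm v).2
  simpa [blockOf] using this

/-! ### Pattern containment read off the word -/

/-- Passes to inverses: an occurrence is described by its set of values instead of its positions,
because the word is indexed by values. -/
lemma contains_iff {π : Equiv.Perm (Fin n)} {k : ℕ} (ρ : Equiv.Perm (Fin k)) :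
    Contains π ρ ↔ ∃ h : Fin k ↪o Fin n, ∀ i j, π.symm (h i) < π.symm (h j) ↔
      ρ.symm i < ρ.symm j := by
  constructor
  · rintro ⟨f, hf⟩
    have hs : StrictMono (fun i => π (f (ρ.symm i))) := fun i j hij => (hf _ _).2 (by simpa)
    exact ⟨OrderEmbedding.ofStrictMono _ hs, fun i j => by simp⟩
  · rintro ⟨h, hh⟩
    have hs : StrictMono (fun i => π.symm (h (ρ i))) := fun i j hij => (hh _ _).2 (by simpa)
    exact ⟨OrderEmbedding.ofStrictMono _ hs, fun i j => by simp⟩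

/-- Equal letters keep the order of values, so values that rise while their positions fall are
exactly those whose letters fall strictly. -/
lemma contains_decreasing_iff {π : Equiv.Perm (Fin n)} {w : Fin n → ℕ} (hw : SortsTo π w) :
    Contains π (decreasing 3).2 ↔ ∃ x y z, [x, y, z] <+ ofFn w ∧ y < x ∧ z < y := by
  rw [contains_iff]
  have rev : ∀ i j : Fin 3, (decreasing 3).2.symm i < (decreasing 3).2.symm j ↔ j < i := by
    intro i j
    exact Fin.rev_lt_rev
  constructor
  · rintro ⟨h, hh⟩
    change Fin 3 ↪o Fin n at h
    have key : ∀ i j : Fin 3, i < j → w (h j) < w (h i) := by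
      intro i j hij
      have h1 := (hw (h j) (h i)).1 ((hh j i).2 ((rev j i).2 hij))
      have h2 : ¬ h j < h i := by simpa using hij.le
      tauto
    refine ⟨w (h 0), w (h 1), w (h 2), ?_, key 0 1 (by simp), key 1 2 (by decide)⟩
    rw [sublist_ofFn_iff]
    refine ⟨h, fun i => ?_⟩
    change Fin 3 at i
    fin_cases i <;> rfl
  · rintro ⟨x, y, z, hs, hxy, hyz⟩
    obtain ⟨h, hh⟩ := sublist_ofFn_iff.1 hs
    change Fin 3 ↪o Fin n at h
    have key : ∀ i j : Fin 3, π.symm (h i) < π.symm (h j) ↔ j < i := by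
      intro i j
      have e0 : x = w (h 0) := hh 0
      have e1 : y = w (h 1) := hh 1
      have e2 : z = w (h 2) := hh 2
      rw [hw]
      fin_cases i <;> fin_cases j <;> simp <;> omega
    exact ⟨h, fun i j => (key i j).trans (rev i j).symm⟩

lemma pairwise_append_iff_getElem {xs ys : List ℕ} {v : ℕ} :
    (xs ++ ys).Pairwise (· ≤ ·) ↔ ∀ (i j : ℕ) (hi : i < (xs ++ v :: ys).length)
      (hj : j < (xs ++ v :: ys).length), i < j → i ≠ xs.length → j ≠ xs.length →
      (xs ++ v :: ys)[i] ≤ (xs ++ v :: ys)[j] := by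
  have hlo : ∀ (i : ℕ) (h : i < (xs ++ ys).length) (h' : i < (xs ++ v :: ys).length),
      i < xs.length → (xs ++ v :: ys)[i] = (xs ++ ys)[i] := by
    intro i h h' hi
    simp [getElem_append_left hi]
  have hhi : ∀ (i : ℕ) (h : i < (xs ++ ys).length) (h' : i + 1 < (xs ++ v :: ys).length),
      xs.length ≤ i → (xs ++ v :: ys)[i + 1] = (xs ++ ys)[i] := by
    intro i h h' hi
    rw [getElem_append_right (by omega), getElem_append_right (by omega)]
    simp [Nat.sub_add_comm hi]
  rw [pairwise_iff_getElem]
  simp only [length_append, length_cons] at *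
  constructor
  · intro H i j hi hj hij hi' hj'
    rcases lt_or_gt_of_ne hi' with hi' | hi' <;> rcases lt_or_gt_of_ne hj' with hj' | hj'
    · rw [hlo i (by omega) hi hi', hlo j (by omega) hj hj']
      exact H _ _ (by omega) (by omega) hij
    · obtain ⟨j, rfl⟩ : ∃ j', j = j' + 1 := ⟨j - 1, by omega⟩
      rw [hlo i (by omega) hi hi', hhi j (by omega) hj (by omega)]
      exact H _ _ (by omega) (by omega) (by omega)
    · omega
    · obtain ⟨i, rfl⟩ : ∃ i', i = i' + 1 := ⟨i - 1, by omega⟩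
      obtain ⟨j, rfl⟩ : ∃ j', j = j' + 1 := ⟨j - 1, by omega⟩
      rw [hhi i (by omega) hi (by omega), hhi j (by omega) hj (by omega)]
      exact H _ _ (by omega) (by omega) (by omega)
  · intro H i j hi hj hij
    by_cases hi' : i < xs.length <;> by_cases hj' : j < xs.length
    · rw [← hlo i hi (by omega) hi', ← hlo j hj (by omega) hj']
      exact H _ _ (by omega) (by omega) hij (by omega) (by omega)
    · rw [← hlo i hi (by omega) hi', ← hhi j hj (by omega) (by omega)]
      exact H _ _ (by omega) (by omega) (by omega) (by omega) (by omega)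
    · omega
    · rw [← hhi i hi (by omega) (by omega), ← hhi j hj (by omega) (by omega)]
      exact H _ _ (by omega) (by omega) (by omega) (by omega) (by omega)

/-- For values `u < v`, `u` stands left of `v` exactly when `w u ≤ w v`. So the values other than
entry number `c`, which plays the element `a = c + 1`, carry a sorted subword, and a pattern other
than the identity means that the whole subword is not sorted. -/
lemma contains_partialShuffle_iff {π : Equiv.Perm (Fin n)} {w : Fin n → ℕ} (hw : SortsTo π w)
    {c b : ℕ} :
    (∃ ρ ∈ partialShuffle (c + 1) b, Contains π ρ.2) ↔ ∃ xs v ys, xs ++ v :: ys <+ ofFn w ∧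
      xs.length = c ∧ ys.length = b ∧ (xs ++ ys).Pairwise (· ≤ ·) ∧
      ¬ (xs ++ v :: ys).Pairwise (· ≤ ·) := by
  have key : (∃ ρ ∈ partialShuffle (c + 1) b, Contains π ρ.2) ↔
      ∃ h : Fin (c + 1 + b) ↪o Fin n,
        (∀ i j : Fin (c + 1 + b), (i : ℕ) ≠ c → (j : ℕ) ≠ c → i < j → w (h i) ≤ w (h j)) ∧
        ∃ i j, i < j ∧ w (h j) < w (h i) := by
    have tr : ∀ (h : Fin (c + 1 + b) ↪o Fin n) (i j), i < j →
        (w (h i) ≤ w (h j) ↔ π.symm (h i) < π.symm (h j)) := by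
      intro h i j hij
      have : h i < h j := by simpa
      rw [hw]
      omega
    constructor
    · rintro ⟨-, ⟨ρ, ⟨h1, h2⟩, rfl⟩, hc⟩
      obtain ⟨h, hh⟩ := (contains_iff ρ).1 hc
      refine ⟨h, ?_, ?_⟩
      · intro i j hi hj hij
        rw [tr h i j hij, hh]
        by_contra hlt
        have hne : ρ.symm i ≠ ρ.symm j := fun e => hij.ne (ρ.symm.injective e)
        have := h2 (ρ.symm j) (ρ.symm i) (by simpa using hj) (by simpa using hi)
          (lt_of_le_of_ne (not_lt.1 hlt) hne.symm)
        simp only [Equiv.apply_symm_apply] at this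
        exact absurd this (not_lt_of_gt hij)
      · by_contra! hcon
        apply h1
        have : ρ.symm = 1 := by
          rw [← Equiv.Perm.monotone_iff]
          apply StrictMono.monotone
          intro i j hij
          rw [← hh, ← tr h i j hij]
          exact hcon i j hij
        exact inv_eq_one.1 this
    · rintro ⟨h, h1, i, j, hij, hlt⟩
      have hinj : Function.Injective (fun i => π.symm (h i)) :=
        fun i j e => h.injective (π.symm.injective e)
      -- Sorting the chosen values by position recovers the pattern: `ρ.symm` ranks them as their
      -- positions do.
      set ρ : Equiv.Perm (Fin (c + 1 + b)) := Tuple.sort (fun i => π.symm (h i)) with hρ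
      have hs : StrictMono ((fun i => π.symm (h i)) ∘ ρ) :=
        (Tuple.monotone_sort _).strictMono_of_injective (hinj.comp ρ.injective)
      have hs' : ∀ i j, π.symm (h i) < π.symm (h j) ↔ ρ.symm i < ρ.symm j := by
        intro i j
        have := hs.lt_iff_lt (a := ρ.symm i) (b := ρ.symm j)
        simpa using this
      refine ⟨⟨_, ρ⟩, ⟨ρ, ⟨?_, ?_⟩, rfl⟩, (contains_iff ρ).2 ⟨h, hs'⟩⟩
      · intro e
        have := (tr h i j hij).2 ((hs' i j).2 (by rw [e]; exact hij))
        omega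
      · intro u v hu hv huv
        by_contra hlt
        have hne : ρ v ≠ ρ u := fun e => huv.ne (ρ.injective e).symm
        have hlt' : ρ v < ρ u := lt_of_le_of_ne (not_lt.1 hlt) hne
        have := (hs' _ _).1 ((tr h _ _ hlt').1 (h1 _ _ (by omega) (by omega) hlt'))
        simp only [Equiv.symm_apply_apply] at this
        exact absurd this (not_lt_of_gt huv)
  rw [key]
  constructor
  · rintro ⟨h, h1, i, j, hij, hlt⟩
    set l := ofFn (fun u => w (h u)) with hl
    have hlen : l.length = c + 1 + b := by simp [l]
    have hsplit : l = l.take c ++ l[c] :: l.drop (c + 1) := by simp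
    have hsub : l <+ ofFn w := by
      rw [sublist_ofFn_iff]
      refine ⟨(Fin.castOrderIso hlen).toOrderEmbedding.trans h, fun i => ?_⟩
      simp only [l, get_ofFn]
      rfl
    have htl : (l.take c).length = c := by simp [hlen]; omega
    refine ⟨l.take c, l[c], l.drop (c + 1), hsplit ▸ hsub, htl, by simp [hlen], ?_, ?_⟩
    · rw [pairwise_append_iff_getElem (v := l[c])]
      rw [htl]
      simp only [← hsplit]
      intro i j hi hj hij hic hjc
      simpa [l] using h1 ⟨i, by omega⟩ ⟨j, by omega⟩ hic hjc hij
    · rw [← hsplit, pairwise_iff_getElem]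
      intro H
      have := H i j (by omega) (by omega) hij
      simp [l] at this
      omega
  · rintro ⟨xs, v, ys, hs, hx, hy, h1, h2⟩
    have hlen : (xs ++ v :: ys).length = c + 1 + b := by simp; omega
    obtain ⟨h, hh⟩ := sublist_ofFn_iff.1 hs
    rw [pairwise_append_iff_getElem (v := v)] at h1
    rw [pairwise_iff_getElem] at h2
    push Not at h2
    obtain ⟨i, j, hi, hj, hij, hlt⟩ := h2
    refine ⟨(Fin.castOrderIso hlen.symm).toOrderEmbedding.trans h, ?_, ⟨i, by omega⟩,
      ⟨j, by omega⟩, hij, ?_⟩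
    · intro i j hi hj hij
      have := h1 i j (by omega) (by omega) hij (by omega) (by omega)
      have e1 := hh ⟨i, by omega⟩
      have e2 := hh ⟨j, by omega⟩
      simp only [get_eq_getElem] at e1 e2
      rw [e1, e2] at this
      exact this
    · have e1 := hh ⟨i, by omega⟩
      have e2 := hh ⟨j, by omega⟩
      simp only [get_eq_getElem] at e1 e2
      rw [e1, e2] at hlt
      exact hlt

lemma mem_Av_iff {π : Equiv.Perm (Fin n)} {w : Fin n → ℕ} (hw : SortsTo π w) {c b : ℕ} :
    π ∈ Av n (partialShuffle (c + 1) b ∪ {decreasing 3}) ↔ Good c b (ofFn w) := by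
  have h1 := contains_partialShuffle_iff hw (c := c) (b := b)
  have h2 := contains_decreasing_iff hw
  have e : π ∈ Av n (partialShuffle (c + 1) b ∪ {decreasing 3}) ↔
      ¬ Contains π (decreasing 3).2 ∧ ¬ ∃ ρ ∈ partialShuffle (c + 1) b, Contains π ρ.2 := by
    simp only [Av, Set.mem_ofPred_eq, Set.mem_union, Set.mem_singleton_iff, or_imp, forall_and,
      forall_eq]
    push Not
    exact and_comm
  rw [e, h1, h2, Good]
  push Not
  rfl

/-- The members of size `n` of the class are counted by good words of length `n`. -/
theorem ncard_Av_eq (n c b : ℕ) :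
    (Av n (partialShuffle (c + 1) b ∪ {decreasing 3})).ncard =
      {W : List ℕ | W.length = n ∧ Good c b W ∧ ∃ d, Proper d W}.ncard := by
  apply Set.ncard_congr (fun π _ => ofFn (blockOf π))
  · intro π hπ
    exact ⟨by simp, (mem_Av_iff (sortsTo_blockOf π)).1 hπ, proper_blockOf π⟩
  · intro π π' _ _ h
    have h := ofFn_injective h
    exact (sortsTo_blockOf π).ext (h ▸ sortsTo_blockOf π')
  · rintro W ⟨rfl, hg, d, hd⟩
    obtain ⟨π, hπ⟩ := exists_sortsTo W.get
    refine ⟨π, (mem_Av_iff hπ).2 (by rwa [ofFn_get]), ?_⟩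
    rw [← hπ.eq_blockOf (d := d) (by rwa [ofFn_get]), ofFn_get]

end PermPattern

/-! ### Sums over vectors of letter counts -/

namespace PermPattern

open Finset Polynomial

/-- Stars and bars: splitting off the value at one index leaves a hockey-stick sum of multichoose
numbers. -/
lemma card_piAntidiag_nat {ι : Type*} [DecidableEq ι] (s : Finset ι) (N : ℕ) :
    (s.piAntidiag N).card = (#s).multichoose N := by
  induction s using Finset.cons_induction generalizing N with
  | empty =>
    cases N with
    | zero => simp
    | succ N => simp [Nat.multichoose_zero_succ]
  | cons i s hi ih =>
    rw [piAntidiag_cons, card_disjiUnion]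
    simp only [card_map, ih, card_cons]
    rw [Nat.sum_antidiagonal_eq_sum_range_succ_mk]
    have h1 := Finset.sum_range_reflect (fun j => (#s).multichoose j) (N + 1)
    have h2 := Nat.sum_range_multichoose N (#s)
    rw [Nat.multichoose_eq, Nat.choose_symm_of_eq_add (b := #s) (by omega)]
    simp only [Nat.add_sub_cancel] at h1
    rw [Nat.succ_eq_add_one, h1, h2]
    congr 1
    omega

lemma coeff_binomPoly (k : ℕ) : (binomPoly k).coeff k = (k.factorial : ℚ)⁻¹ := by
  have h := monic_descPochhammer ℚ k
  rw [Monic, leadingCoeff, descPochhammer_natDegree] at h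
  rw [binomPoly, coeff_C_mul, h, mul_one]

lemma natDegree_binomPoly_le (k : ℕ) : (binomPoly k).natDegree ≤ k := by
  rw [binomPoly]
  exact (natDegree_C_mul_le _ _).trans (descPochhammer_natDegree ℚ k).le

lemma degree_sub_binomPoly_lt {p : ℚ[X]} {c : ℚ} {k : ℕ} (hp : p.natDegree ≤ k)
    (hc : p.coeff k = c * (k.factorial : ℚ)⁻¹) : (p - C c * binomPoly k).degree < (k : WithBot ℕ) := by
  rw [degree_lt_iff_coeff_zero]
  intro j hj
  rw [coeff_sub, coeff_C_mul]
  rcases (show k ≤ j from hj).eq_or_lt with rfl | hj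
  · rw [hc, coeff_binomPoly, sub_self]
  · rw [coeff_eq_zero_of_natDegree_lt (hp.trans_lt hj),
      coeff_eq_zero_of_natDegree_lt ((natDegree_binomPoly_le k).trans_lt hj)]
    simp

/-- The number of vectors with sum `n` and a given truncation at height `K` is eventually
polynomial in `n`. -/
lemma exists_poly_card_truncated {r : ℕ} (K : ℕ) (t : Fin (r + 1) → ℕ) (ht : ∀ i, t i ≤ K) :
    ∃ p : ℚ[X], (∀ᶠ n in Filter.atTop,
      ((#{g ∈ piAntidiag univ n | (fun i => min (g i) K) = t} : ℕ) : ℚ) = p.eval (n : ℚ)) ∧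
      p.natDegree ≤ r ∧ p.coeff r = if t = (fun _ => K) then (r.factorial : ℚ)⁻¹ else 0 := by
  -- Coordinates outside `F` are determined by `t`; those in `F` are only bounded below by `K`.
  -- Subtracting `t` leaves an arbitrary vector on `F` with sum `n - S`, so the degree is `#F - 1`,
  -- equal to `r` only when every coordinate is truncated.
  set F : Finset (Fin (r + 1)) := {i | t i = K} with hF
  set S := ∑ i, t i with hS
  have hcard : ∀ n, S ≤ n →
      #{g ∈ piAntidiag univ n | (fun i => min (g i) K) = t} = (#F).multichoose (n - S) := by
    intro n hn
    rw [← card_piAntidiag_nat]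
    refine Finset.card_bij' (fun g _ i => g i - t i) (fun u _ i => u i + t i) ?_ ?_ ?_ ?_
    · intro g hg
      simp only [mem_filter, mem_piAntidiag] at hg
      obtain ⟨⟨h1, -⟩, h2⟩ := hg
      have h3 : ∀ i, min (g i) K = t i := fun i => congrFun h2 i
      have h4 : ∀ i ∉ F, g i - t i = 0 := by
        intro i hi
        have := h3 i; have := ht i
        simp only [F, mem_filter, mem_univ, true_and] at hi
        omega
      rw [mem_piAntidiag]
      refine ⟨?_, fun i hi => by_contra fun h => hi (h4 i h)⟩
      rw [sum_subset (subset_univ F) (fun i _ hi => h4 i hi), ← h1, hS, Finset.sum_tsub_distrib]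
      intro i _
      have := h3 i
      omega
    · intro u hu
      simp only [mem_piAntidiag] at hu
      obtain ⟨h1, h2⟩ := hu
      have h2 : ∀ i, i ∉ F → u i = 0 := fun i hi => by_contra fun h => hi (h2 i h)
      rw [sum_subset (subset_univ F) (fun i _ hi => h2 i hi)] at h1
      simp only [mem_filter, mem_piAntidiag, mem_univ, implies_true, and_true]
      refine ⟨by rw [sum_add_distrib, h1]; omega, funext fun i => ?_⟩
      by_cases hi : i ∈ F
      · simp only [F, mem_filter, mem_univ, true_and] at hi
        omega
      · have := h2 i hi; have := ht i; omega
    · intro g hg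
      simp only [mem_filter, mem_piAntidiag] at hg
      obtain ⟨-, h2⟩ := hg
      funext i
      have : min (g i) K = t i := congrFun h2 i
      simp only
      omega
    · intro u _
      funext i
      simp
  by_cases hFe : F = ∅
  · refine ⟨0, ?_, by simp, ?_⟩
    · filter_upwards [Filter.eventually_gt_atTop S] with n hn
      rw [hcard n hn.le, hFe]
      obtain ⟨N, hN⟩ : ∃ N, n - S = N + 1 := ⟨n - S - 1, by omega⟩
      simp [hN, Nat.multichoose_zero_succ]
    · rw [if_neg]
      · simp
      · rintro h
        have : (0 : Fin (r + 1)) ∈ F := by simp [F, h]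
        simp [hFe] at this
  · obtain ⟨f, hf⟩ : ∃ f, #F = f + 1 :=
      ⟨#F - 1, by have := Finset.card_pos.2 (nonempty_iff_ne_empty.2 hFe); omega⟩
    have hfr : f ≤ r := by
      have := card_le_univ F
      rw [Fintype.card_fin] at this
      omega
    refine ⟨preHilbertPoly ℚ f S, ?_, (natDegree_preHilbertPoly ℚ f S).trans_le hfr, ?_⟩
    · filter_upwards [Filter.eventually_ge_atTop S] with n hn
      rw [hcard n hn, hf, preHilbertPoly_eq_choose_sub_add ℚ f hn, Nat.multichoose_eq,
        Nat.choose_symm_of_eq_add (b := f) (by omega)]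
      congr 2
      omega
    · split_ifs with h
      · have : f = r := by
          have : F = univ := by ext i; simp [F, h]
          rw [this, card_univ, Fintype.card_fin] at hf
          omega
        rw [this, coeff_preHilbertPoly_self]
      · have hlt : f < r := by
          refine lt_of_le_of_ne hfr fun hfr => h (funext fun i => ?_)
          have : F = univ := by
            rw [← card_eq_iff_eq_univ, hf, hfr, Fintype.card_fin]
          have : i ∈ F := this ▸ mem_univ i
          simpa [F] using this
        exact coeff_eq_zero_of_natDegree_lt (by rwa [natDegree_preHilbertPoly])

/-- If `H` depends only on the truncation of its argument at height `K`, then the sum of `H` over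
the vectors with sum `n` is eventually polynomial in `n`. -/
theorem exists_poly_sum_truncated {r : ℕ} (K : ℕ) (H : (Fin (r + 1) → ℕ) → ℕ)
    (hH : ∀ g, H g = H (fun i => min (g i) K)) :
    ∃ p : ℚ[X], (∀ᶠ n in Filter.atTop,
      ((∑ g ∈ piAntidiag univ n, H g : ℕ) : ℚ) = p.eval (n : ℚ)) ∧
      p.natDegree ≤ r ∧ p.coeff r = H (fun _ => K) * (r.factorial : ℚ)⁻¹ := by
  set T : Finset (Fin (r + 1) → ℕ) := Fintype.piFinset fun _ => range (K + 1) with hT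
  have hTle : ∀ t ∈ T, ∀ i, t i ≤ K := by
    intro t ht i
    have := Fintype.mem_piFinset.1 ht i
    simp at this
    omega
  -- Group the vectors by their truncation `t`, on which `H` is constant; only the constant vector
  -- `K` contributes to degree `r`.
  choose! p hp using fun t (ht : t ∈ T) => exists_poly_card_truncated K t (hTle t ht)
  refine ⟨∑ t ∈ T, C (H t : ℚ) * p t, ?_, ?_, ?_⟩
  · have h := (Filter.eventually_all_finset T).2 fun t ht => (hp t ht).1
    filter_upwards [h] with n hn
    have hmaps : ∀ g ∈ piAntidiag univ n, (fun i => min (g i) K) ∈ T := by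
      intro g _
      simp [hT]
    rw [← sum_fiberwise_of_maps_to hmaps, eval_finsetSum, Nat.cast_sum]
    apply sum_congr rfl
    intro t ht
    rw [eval_C_mul, ← hn t ht, sum_congr rfl (g := fun _ => H t)]
    · simp [mul_comm]
    · intro g hg
      rw [hH, (mem_filter.1 hg).2]
  · refine natDegree_sum_le_of_forall_le _ _ fun t ht => ?_
    exact (natDegree_C_mul_le _ _).trans (hp t ht).2.1
  · rw [finsetSum_coeff, sum_eq_single_of_mem (fun _ => K) (by simp [hT])]
    · rw [coeff_C_mul, (hp _ (by simp [hT])).2.2, if_pos rfl]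
    · intro t ht hne
      rw [coeff_C_mul, (hp t ht).2.2, if_neg hne, mul_zero]

end PermPattern

/-! ### Few letters, and long runs of frequent letters -/

namespace PermPattern

open List

variable {c b d : ℕ} {W : List ℕ}

lemma pair_sublist_right {x y : ℕ} {P Q : List ℕ} (h : [x, y] <+ P ++ Q) (hx : x ∉ P) :
    [x, y] <+ Q := by
  induction P with
  | nil => simpa using h
  | cons a P ih =>
    simp only [mem_cons, not_or] at hx
    rw [cons_append, cons_sublist_cons'] at h
    exact ih (h.resolve_right fun h => hx.1 h.1) hx.2

lemma pair_sublist_left {x y : ℕ} {P Q : List ℕ} (h : [x, y] <+ P ++ Q) (hy : y ∉ Q) :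
    [x, y] <+ P := by
  have h' := reverse_sublist.2 h
  rw [reverse_append] at h'
  have := pair_sublist_right (x := y) (y := x) h' (by simpa)
  rw [← reverse_sublist]
  simpa

lemma append_cons_inj_of_count_eq {α : Type*} [DecidableEq α] {k : α} {P R P' R' : List α}
    (h : P ++ k :: R = P' ++ k :: R') (hc : count k P = count k P') : P = P' ∧ R = R' := by
  induction P generalizing P' with
  | nil =>
    cases P' with
    | nil => simpa using h
    | cons a P' =>
      simp only [nil_append, cons_append, cons.injEq] at h
      simp [h.1] at hc
  | cons a P ih =>
    cases P' with
    | nil =>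
      simp only [nil_append, cons_append, cons.injEq] at h
      simp [h.1] at hc
    | cons a' P' =>
      simp only [cons_append, cons.injEq] at h
      obtain ⟨rfl, h⟩ := h
      have := ih h (by simpa [count_cons] using hc)
      simp [this]

lemma exists_append_of_le_count {α : Type*} [DecidableEq α] {k : α} {W : List α} {j : ℕ}
    (h : j ≤ count k W) : ∃ P R, W = P ++ R ∧ count k P = j := by
  induction W generalizing j with
  | nil => exact ⟨[], [], rfl, by simp_all⟩
  | cons a W ih =>
    rcases Nat.eq_zero_or_pos j with rfl | hj
    · exact ⟨[], _, rfl, rfl⟩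
    · by_cases ha : a = k
      · subst ha
        rw [count_cons_self] at h
        obtain ⟨P, R, rfl, hP⟩ := ih (show j - 1 ≤ _ by omega)
        exact ⟨a :: P, R, rfl, by rw [count_cons_self]; omega⟩
      · rw [count_cons_of_ne (by simpa using ha)] at h
        obtain ⟨P, R, rfl, hP⟩ := ih h
        exact ⟨a :: P, R, rfl, by rw [count_cons_of_ne (by simpa using ha), hP]⟩

/-- A subword of length at most `j` uses at most `j` copies from the run. -/
lemma sublist_of_append_replicate_succ {P Q l : List ℕ} {k j : ℕ}
    (h : l <+ P ++ replicate (j + 1) k ++ Q) (hl : l.length ≤ j) :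
    l <+ P ++ replicate j k ++ Q := by
  obtain ⟨l12, l3, rfl, h12, h3⟩ := sublist_append_iff.1 h
  obtain ⟨l1, l2, rfl, h1, h2⟩ := sublist_append_iff.1 h12
  refine (h1.append ?_).append h3
  obtain ⟨i, -, rfl⟩ := sublist_replicate_iff.1 h2
  simp only [length_append, length_replicate] at hl
  exact (replicate_sublist_replicate k).2 (by omega)

lemma sublist_append_replicate_succ (P Q : List ℕ) (k j : ℕ) :
    P ++ replicate j k ++ Q <+ P ++ replicate (j + 1) k ++ Q :=
  ((Sublist.refl P).append ((replicate_sublist_replicate k).2 (by omega))).append (Sublist.refl Q)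

lemma Good.mono {V : List ℕ} (h : Good c b W) (hV : V <+ W) : Good c b V :=
  ⟨fun x y z hs => h.1 x y z (hs.trans hV), fun xs v ys hs => h.2 xs v ys (hs.trans hV)⟩

/-- The forbidden subwords have length `3` or `c + b + 1`, both at most `c + b + 3`, so they cannot
detect one more copy in the run. -/
lemma good_replicate_succ_iff {P Q : List ℕ} {k j : ℕ} (hj : c + b + 3 ≤ j) :
    Good c b (P ++ replicate (j + 1) k ++ Q) ↔ Good c b (P ++ replicate j k ++ Q) := by
  refine ⟨fun h => h.mono (sublist_append_replicate_succ _ _ _ _), fun h => ⟨?_, ?_⟩⟩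
  · intro x y z hs
    exact h.1 x y z (sublist_of_append_replicate_succ hs (by simp; omega))
  · intro xs v ys hs hx hy
    exact h.2 xs v ys (sublist_of_append_replicate_succ hs (by simp; omega)) hx hy

lemma proper_replicate_succ_iff {P Q : List ℕ} {k j : ℕ} (hj : 2 ≤ j) :
    Proper d (P ++ replicate (j + 1) k ++ Q) ↔ Proper d (P ++ replicate j k ++ Q) := by
  constructor
  · rintro ⟨h1, h2⟩
    exact ⟨fun x hx => h1 x ((sublist_append_replicate_succ _ _ _ _).subset hx),
      fun i hi => sublist_of_append_replicate_succ (h2 i hi) (by simpa)⟩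
  · rintro ⟨h1, h2⟩
    refine ⟨fun x hx => h1 x ?_, fun i hi => (h2 i hi).trans (sublist_append_replicate_succ _ _ _ _)⟩
    simp only [mem_append, mem_replicate] at hx ⊢
    rcases hx with (hx | hx) | hx
    · exact Or.inl (Or.inl hx)
    · exact Or.inl (Or.inr ⟨by omega, hx.2⟩)
    · exact Or.inr hx

lemma Good.le_right (h : Good c b W) {xs ys : List ℕ} {v : ℕ} (hs : xs ++ v :: ys <+ W)
    (hx : xs.length = c) (hy : ys.length = b) (hp : (xs ++ ys).Pairwise (· ≤ ·)) :
    ∀ y ∈ ys, v ≤ y := by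
  have := (pairwise_append.1 (h.2 xs v ys hs hx hy hp)).2.1
  exact (pairwise_cons.1 this).1

lemma Good.le_left (h : Good c b W) {xs ys : List ℕ} {v : ℕ} (hs : xs ++ v :: ys <+ W)
    (hx : xs.length = c) (hy : ys.length = b) (hp : (xs ++ ys).Pairwise (· ≤ ·)) :
    ∀ x ∈ xs, x ≤ v := by
  have := (pairwise_append.1 (h.2 xs v ys hs hx hy hp)).2.2
  exact fun x hx => this x hx v (by simp)

/-- If no `v + 1` preceded a given `v + 2`, the pair `v + 1`, `v` supplied by properness would come
after it and complete a decreasing triple. Descend from there; `0` itself need not precede. -/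
lemma Good.range'_sublist_before (h : Good c b W) (hd : Proper d W) {v : ℕ} {P Q : List ℕ}
    (hW : W = P ++ (v + 1) :: Q) : range' 1 v <+ P := by
  induction v generalizing P Q with
  | zero => simp
  | succ v ih =>
    have hvd : v + 2 ≤ d := hd.1 _ (by simp [hW])
    have hmem : v + 1 ∈ P := by
      by_contra hP
      have h1 := hd.2 v (by omega)
      rw [hW] at h1
      have h2 := pair_sublist_right h1 hP
      rw [cons_sublist_cons'] at h2
      have h3 := h2.resolve_right (by omega)
      refine h.1 (v + 2) (v + 1) v ?_ (by omega) (by omega)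
      rw [hW]
      exact (h3.cons_cons _).trans (sublist_append_right _ _)
    obtain ⟨P1, P2, rfl⟩ := append_of_mem hmem
    have := ih (P := P1) (Q := P2 ++ (v + 2) :: Q) (by simp [hW])
    rw [range'_concat]
    exact this.append (by simp [add_comm])

/-- The mirror image: without a `v + 1` after a given `v`, the pair `v + 2`, `v + 1` would precede
it and give a decreasing triple. -/
lemma Good.range'_sublist_after (h : Good c b W) (hd : Proper d W) {v k : ℕ} {P Q : List ℕ}
    (hk : v + k + 1 = d) (hW : W = P ++ v :: Q) : range' (v + 1) k <+ Q := by
  induction k generalizing v P Q with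
  | zero => simp
  | succ k ih =>
    have hmem : v + 1 ∈ Q := by
      by_contra hQ
      have h1 := hd.2 (v + 1) (by omega)
      rw [hW, ← concat_append] at h1
      have h2 := pair_sublist_left h1 hQ
      rw [concat_eq_append] at h2
      have h3 := pair_sublist_left h2 (by simp)
      refine h.1 (v + 2) (v + 1) v ?_ (by omega) (by omega)
      rw [hW]
      exact h3.append (by simp : [v] <+ v :: Q)
    obtain ⟨Q1, Q2, rfl⟩ := append_of_mem hmem
    have := ih (v := v + 1) (P := P ++ v :: Q1) (Q := Q2) (by omega) (by simp [hW])
    rw [range'_succ]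
    exact (this.cons_cons _).trans (sublist_append_right _ _)

/-- With too many letters, take a `c + 1` before a `c` and extend on both sides to `1, …, c, c + 1,
c, c + 1, …, c + b - 1`. Entry number `c` is the first `c + 1`; without it the word is sorted, with
it the word is not. For `b = 0` the word is `1, …, c, c - 1`, whose last entry is the one removed.
-/
lemma Good.lt_of_proper (h : Good c b W) (hd : Proper d W) (hcb : 1 ≤ c + b) : d < c + b := by
  by_contra! hlt
  rcases Nat.eq_zero_or_pos b with rfl | hb
  · obtain ⟨c, rfl⟩ : ∃ c', c = c' + 1 := ⟨c - 1, by omega⟩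
    have h1 := hd.2 c (by omega)
    obtain ⟨P, Q, hW, hQ⟩ : ∃ P Q, W = P ++ (c + 1) :: Q ∧ c ∈ Q := by
      obtain ⟨r1, r2, rfl, h2, h3⟩ := cons_sublist_iff.1 h1
      obtain ⟨P, Q, rfl⟩ := append_of_mem h2
      exact ⟨P, Q ++ r2, by simp, by simp [singleton_sublist.1 h3]⟩
    have h2 := h.range'_sublist_before hd hW
    have := h.le_left (xs := range' 1 (c + 1)) (v := c) (ys := []) (by
      rw [hW, range'_concat, append_assoc]
      refine h2.append ?_
      simpa [add_comm] using hQ) (by simp) rfl (by simpa using pairwise_le_range') (c + 1)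
      (by simp)
    omega
  · have h1 := hd.2 c (by omega)
    obtain ⟨P, Q, hW, hQ⟩ : ∃ P Q, W = P ++ (c + 1) :: Q ∧ c ∈ Q := by
      obtain ⟨r1, r2, rfl, h2, h3⟩ := cons_sublist_iff.1 h1
      obtain ⟨P, Q, rfl⟩ := append_of_mem h2
      exact ⟨P, Q ++ r2, by simp, by simp [singleton_sublist.1 h3]⟩
    obtain ⟨Q1, Q2, rfl⟩ := append_of_mem hQ
    have h2 := h.range'_sublist_before hd hW
    have h3 := h.range'_sublist_after hd (v := c) (k := d - c - 1) (P := P ++ (c + 1) :: Q1)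
      (Q := Q2) (by omega) (by simp [hW])
    have h4 : range' (c + 1) (b - 1) <+ Q2 :=
      (range'_sublist_right.2 (by omega)).trans h3
    have := h.le_right (xs := range' 1 c) (v := c + 1) (ys := c :: range' (c + 1) (b - 1)) (by
      rw [hW]
      exact h2.append (((h4.cons_cons _).trans (sublist_append_right _ _)).cons_cons _))
      (by simp) (by simp; omega) (by
        rw [pairwise_append]
        refine ⟨pairwise_le_range', ?_, ?_⟩
        · rw [pairwise_cons]
          exact ⟨fun x hx => by simp at hx; omega, pairwise_le_range'⟩
        · intro x hx y hy
          simp at hx hy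
          omega) c (by simp)
    omega

/-- In `k ⋯ k x k ⋯ k` with `x` as entry number `c`, removing `x` leaves a constant word. If `x < k`
and `c = 0`, or `x > k` and `b = 0`, that word is already sorted, and a neighbouring `k` is made the
removed entry instead. -/
lemma Good.eq_of_between (h : Good c b W) (hcb : 1 ≤ c + b) {k x : ℕ}
    (hs : replicate (c + 1) k ++ x :: replicate (b + 1) k <+ W) : x = k := by
  by_contra hne
  have sorted : ∀ n, (replicate n k).Pairwise (· ≤ ·) := fun n => by simp [pairwise_replicate]
  rcases lt_or_gt_of_ne hne with hlt | hlt
  · rcases Nat.eq_zero_or_pos c with rfl | hc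
    · have := h.le_right (xs := []) (v := k) (ys := x :: replicate (b - 1) k)
        (Sublist.trans (by simp; omega) hs) rfl (by simp; omega) (by simp [pairwise_replicate]; omega) x
        (by simp)
      omega
    · have := h.le_left (xs := replicate c k) (v := x) (ys := replicate b k)
        (Sublist.trans (((replicate_sublist_replicate k).2 (by omega)).append
          (((replicate_sublist_replicate k).2 (by omega)).cons_cons _)) hs)
        (by simp) (by simp) (by rw [← replicate_add]; exact sorted _) k (by simp; omega)
      omega
  · rcases Nat.eq_zero_or_pos b with rfl | hb
    · have := h.le_left (xs := replicate (c - 1) k ++ [x]) (v := k) (ys := [])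
        (Sublist.trans (by
          rw [append_assoc]
          exact ((replicate_sublist_replicate k).2 (by omega)).append (by simp)) hs)
        (by simp; omega) rfl (by simp [pairwise_append, pairwise_replicate]; omega) x (by simp)
      omega
    · have := h.le_right (xs := replicate c k) (v := x) (ys := replicate b k)
        (Sublist.trans (((replicate_sublist_replicate k).2 (by omega)).append
          (((replicate_sublist_replicate k).2 (by omega)).cons_cons _)) hs)
        (by simp) (by simp) (by rw [← replicate_add]; exact sorted _) k (by simp; omega)
      omega

lemma Good.exists_run (h : Good c b W) (hcb : 1 ≤ c + b) {k j : ℕ}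
    (hk : count k W = c + b + 2 + j) : ∃ P Q, W = P ++ replicate j k ++ Q ∧ count k P = c + 1 ∧
      count k Q = b + 1 := by
  obtain ⟨P, R, rfl, hP⟩ := exists_append_of_le_count (show c + 1 ≤ count k W by omega)
  rw [count_append] at hk
  obtain ⟨M, Q, rfl, hM⟩ := exists_append_of_le_count (show j ≤ count k R by omega)
  rw [count_append] at hk
  have hMk : ∀ x ∈ M, k = x := by
    intro x hx
    refine (h.eq_of_between hcb (k := k) (x := x) ?_).symm
    refine (replicate_sublist_iff.2 hP.ge).append ?_
    have h1 : [x] <+ M := singleton_sublist.2 hx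
    exact h1.append (replicate_sublist_iff.2 (show b + 1 ≤ count k Q by omega))
  have hMj : M = replicate j k := by
    rw [count_eq_length.2 hMk] at hM
    exact eq_replicate_iff.2 ⟨hM, fun x hx => (hMk x hx).symm⟩
  exact ⟨P, Q, by rw [hMj, append_assoc], hP, by omega⟩

/-- The good proper words over the letters `0, …, d` with prescribed letter counts. -/
def goodWords (c b d : ℕ) (g : Fin (d + 1) → ℕ) : Set (List ℕ) :=
  {W | Good c b W ∧ Proper d W ∧ ∀ k : Fin (d + 1), count (k : ℕ) W = g k}

lemma ncard_goodWords_add_single (hcb : 1 ≤ c + b) (g : Fin (d + 1) → ℕ) (k : Fin (d + 1))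
    (hk : 2 * c + 2 * b + 5 ≤ g k) :
    (goodWords c b d (g + Pi.single k 1)).ncard = (goodWords c b d g).ncard := by
  -- Of the `g k` occurrences, `c + 1` precede and `b + 1` follow the run of length `j`. The
  -- threshold is `(c + b + 2) + (c + b + 3)`, where the second summand is the length that
  -- `good_replicate_succ_iff` requires.
  obtain ⟨j, hj⟩ : ∃ j, g k = c + b + 2 + j := ⟨g k - (c + b + 2), by omega⟩
  have hj3 : c + b + 3 ≤ j := by omega
  choose! P Q hPQ hP hQ using fun W (hW : W ∈ goodWords c b d g) =>
    hW.1.exists_run hcb (k := k) (j := j) (by rw [hW.2.2, hj])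
  -- The run starts at a prescribed occurrence of `k`, so lengthening it loses no information.
  have uniq : ∀ {A B A' B' : List ℕ} {i : ℕ}, 0 < i → A ++ replicate i (k : ℕ) ++ B =
      A' ++ replicate i (k : ℕ) ++ B' → count (k : ℕ) A = count (k : ℕ) A' → A = A' ∧ B = B' := by
    intro A B A' B' i hi h hA
    obtain ⟨i, rfl⟩ : ∃ i', i = i' + 1 := ⟨i - 1, by omega⟩
    simp only [replicate_succ, append_assoc, cons_append] at h
    obtain ⟨h1, h2⟩ := append_cons_inj_of_count_eq h hA
    exact ⟨h1, (append_cancel_left h2)⟩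
  have counts : ∀ (A B : List ℕ) (i : Fin (d + 1)),
      count (i : ℕ) (A ++ replicate (j + 1) (k : ℕ) ++ B) =
      count (i : ℕ) (A ++ replicate j (k : ℕ) ++ B) + (Pi.single k 1 : Fin (d + 1) → ℕ) i := by
    intro A B i
    by_cases hi : i = k
    · subst hi
      simp only [count_append, count_replicate_self, Pi.single_eq_same]
      omega
    · have : (k : ℕ) ≠ i := fun e => hi (Fin.ext e.symm)
      simp [count_append, count_replicate, this, hi]
  symm
  apply Set.ncard_congr (fun W _ => P W ++ replicate (j + 1) (k : ℕ) ++ Q W)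
  · intro W hW
    have e := hPQ W hW
    obtain ⟨h1, h2, h3⟩ := id hW
    refine ⟨?_, ?_, fun i => ?_⟩
    · rw [good_replicate_succ_iff hj3, ← e]; exact h1
    · rw [proper_replicate_succ_iff (by omega), ← e]; exact h2
    · rw [counts, ← e, h3]; rfl
  · intro W W' hW hW' h
    obtain ⟨h1, h2⟩ := uniq (by omega) h ((hP W hW).trans (hP W' hW').symm)
    rw [hPQ W hW, hPQ W' hW', h1, h2]
  · rintro V ⟨h1, h2, h3⟩
    obtain ⟨A, B, rfl, hA, hB⟩ := h1.exists_run hcb (k := k) (j := j + 1)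
      (by rw [h3]; simp; omega)
    have hW : A ++ replicate j (k : ℕ) ++ B ∈ goodWords c b d g := by
      refine ⟨(good_replicate_succ_iff hj3).1 h1, (proper_replicate_succ_iff (by omega)).1 h2,
        fun i => ?_⟩
      have := h3 i
      rw [counts] at this
      simpa using this
    refine ⟨_, hW, ?_⟩
    obtain ⟨e1, e2⟩ := uniq (by omega) (hPQ _ hW) (hA.trans (hP _ hW).symm)
    rw [← e1, ← e2]

/-- Induction on the total excess over the threshold, lowering one count by one each time. -/
lemma ncard_goodWords_min (hcb : 1 ≤ c + b) (g : Fin (d + 1) → ℕ) :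
    (goodWords c b d g).ncard =
      (goodWords c b d (fun i => min (g i) (2 * c + 2 * b + 5))).ncard := by
  set K := 2 * c + 2 * b + 5 with hK
  induction hN : ∑ i, (g i - K) generalizing g with
  | zero =>
    congr 2
    funext i
    have := Finset.sum_eq_zero_iff.1 hN i (Finset.mem_univ i)
    omega
  | succ N ih =>
    obtain ⟨k, hk⟩ : ∃ k, K < g k := by
      by_contra! hle
      rw [Finset.sum_eq_zero fun i _ => by have := hle i; omega] at hN
      omega
    set g' : Fin (d + 1) → ℕ := Function.update g k (g k - 1) with hg'
    have hg : g = g' + Pi.single k 1 := by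
      funext i
      by_cases hi : i = k
      · subst hi; simp [g']; omega
      · simp [g', hi]
    have hsum : ∑ i, (g' i - K) = N := by
      have h1 := Finset.add_sum_erase Finset.univ (fun i => g i - K) (Finset.mem_univ k)
      have h2 := Finset.add_sum_erase Finset.univ (fun i => g' i - K) (Finset.mem_univ k)
      have h3 : ∑ i ∈ Finset.univ.erase k, (g' i - K) = ∑ i ∈ Finset.univ.erase k, (g i - K) :=
        Finset.sum_congr rfl fun i hi => by simp [g', Finset.ne_of_mem_erase hi]
      simp only [g', Function.update_self] at h1 h2 h3
      simp only [g']
      omega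
    have hmin : (fun i => min (g i) K) = fun i => min (g' i) K := by
      funext i
      by_cases hi : i = k
      · subst hi; simp only [g', Function.update_self]; omega
      · simp [g', hi]
    rw [hmin, ← ih g' hsum]
    conv_lhs => rw [hg]
    apply ncard_goodWords_add_single hcb
    simp only [g', Function.update_self]
    omega

lemma finite_bounded_words (n d : ℕ) : {W : List ℕ | W.length = n ∧ ∀ x ∈ W, x ≤ d}.Finite := by
  refine ((List.finite_length_eq (Fin (d + 1)) n).image (List.map Fin.val)).subset ?_
  rintro W ⟨hn, hW⟩
  refine ⟨W.pmap (fun x hx => ⟨x, hx⟩) (fun x hx => Nat.lt_succ_of_le (hW x hx)), ?_, ?_⟩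
  · simpa using hn
  · rw [map_pmap]; simp

lemma length_eq_sum_count (hW : ∀ x ∈ W, x ≤ d) : W.length = ∑ i : Fin (d + 1), count (i : ℕ) W := by
  induction W with
  | nil => simp
  | cons a W ih =>
    have ha : a < d + 1 := by have := hW a (by simp); omega
    have e : ∀ i : Fin (d + 1), count (i : ℕ) (a :: W) =
        count (i : ℕ) W + if (⟨a, ha⟩ : Fin (d + 1)) = i then 1 else 0 := by
      intro i
      rw [count_cons]
      simp [Fin.ext_iff]
    rw [length_cons, ih fun x hx => hW x (by simp [hx])]
    simp only [e, Finset.sum_add_distrib, Finset.sum_ite_eq, Finset.mem_univ, if_true]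

lemma Proper.unique {d' : ℕ} (h : Proper d W) (h' : Proper d' W) : d = d' := by
  have key : ∀ {d d'}, Proper d W → Proper d' W → d ≤ d' := by
    intro d d' h h'
    rcases Nat.eq_zero_or_pos d with rfl | hd
    · simp
    · have := h.2 (d - 1) (by omega)
      exact h'.1 d (this.subset (by simp; omega))
  exact le_antisymm (key h h') (key h' h)

/-- The words counting the class, sorted by their largest letter and their letter counts. -/
lemma ncard_words_eq_sum (hcb : 1 ≤ c + b) (n : ℕ) :
    {W : List ℕ | W.length = n ∧ Good c b W ∧ ∃ d, Proper d W}.ncard =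
      ∑ d ∈ Finset.range (c + b), ∑ g ∈ Finset.piAntidiag Finset.univ n,
        (goodWords c b d g).ncard := by
  classical
  have fin : ∀ d, {W : List ℕ | W.length = n ∧ Good c b W ∧ Proper d W}.Finite := fun d =>
    (finite_bounded_words n d).subset fun W hW => ⟨hW.1, hW.2.2.1⟩
  have e1 : {W : List ℕ | W.length = n ∧ Good c b W ∧ ∃ d, Proper d W} =
      ↑((Finset.range (c + b)).biUnion fun d => (fin d).toFinset) := by
    ext W
    simp only [Finset.coe_biUnion, Finset.mem_coe, Finset.mem_range, Set.Finite.coe_toFinset,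
      Set.mem_iUnion, Set.mem_ofPred_eq, exists_prop]
    constructor
    · rintro ⟨h1, h2, d, h3⟩
      exact ⟨d, h2.lt_of_proper h3 hcb, h1, h2, h3⟩
    · rintro ⟨d, -, h1, h2, h3⟩
      exact ⟨h1, h2, d, h3⟩
  rw [e1, Set.ncard_coe_finset, Finset.card_biUnion]
  · refine Finset.sum_congr rfl fun d _ => ?_
    rw [Finset.card_eq_sum_card_fiberwise (f := fun W (i : Fin (d + 1)) => count (i : ℕ) W)
      (t := Finset.piAntidiag Finset.univ n)]
    · refine Finset.sum_congr rfl fun g hg => ?_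
      rw [← Set.ncard_coe_finset]
      congr 1
      ext W
      simp only [Finset.coe_filter, Set.Finite.mem_toFinset, Set.mem_ofPred_eq, goodWords]
      constructor
      · rintro ⟨⟨-, h2, h3⟩, rfl⟩
        exact ⟨h2, h3, fun k => rfl⟩
      · rintro ⟨h2, h3, h4⟩
        refine ⟨⟨?_, h2, h3⟩, funext h4⟩
        rw [length_eq_sum_count h3.1, ← (Finset.mem_piAntidiag.1 hg).1]
        exact Finset.sum_congr rfl fun i _ => h4 i
    · intro W hW
      have hW := (fin d).mem_toFinset.1 hW
      rw [Finset.mem_coe, Finset.mem_piAntidiag]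
      exact ⟨(length_eq_sum_count hW.2.2.1).symm.trans hW.1, fun i _ => Finset.mem_univ i⟩
  · intro d _ d' _ hdd'
    rw [Function.onFun, Finset.disjoint_left]
    intro W hW hW'
    have hW := (fin d).mem_toFinset.1 hW
    have hW' := (fin d').mem_toFinset.1 hW'
    exact hdd' (hW.2.2.unique hW'.2.2)

end PermPattern

/-! ### Words of the given shape are good -/

namespace PermPattern

open List

variable {c b κ : ℕ} {W X Y Z : List ℕ}

lemma append_eq_append_cons {α : Type*} {L R P Q : List α} {v : α} (h : L ++ R = P ++ v :: Q) :
    (∃ L', L = P ++ v :: L' ∧ Q = L' ++ R) ∨ ∃ R', P = L ++ R' ∧ R = R' ++ v :: Q := by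
  rcases append_eq_append_iff.1 h with ⟨A, h1, h2⟩ | ⟨A, h1, h2⟩
  · exact Or.inr ⟨A, h1, h2⟩
  · cases A with
    | nil => exact Or.inr ⟨[], by simpa using h1.symm, by simpa using h2.symm⟩
    | cons a A =>
      simp only [cons_append, cons.injEq] at h2
      obtain ⟨rfl, h2⟩ := h2
      exact Or.inl ⟨A, h1, h2⟩

lemma exists_split_of_sublist {α : Type*} {xs ys W : List α} {v : α} (h : xs ++ v :: ys <+ W) :
    ∃ P Q, W = P ++ v :: Q ∧ xs <+ P ∧ ys <+ Q := by
  obtain ⟨r1, r2, rfl, h1, h2⟩ := append_sublist_iff.1 h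
  obtain ⟨s1, s2, rfl, h3, h4⟩ := cons_sublist_iff.1 h2
  obtain ⟨A, B, rfl⟩ := append_of_mem h3
  exact ⟨r1 ++ A, B ++ s2, by simp, h1.trans (sublist_append_left _ _),
    h4.trans (sublist_append_right _ _)⟩

lemma sublist_of_forall_notMem_right {α : Type*} {l P Q : List α} (h : l <+ P ++ Q)
    (hQ : ∀ x ∈ l, x ∉ Q) : l <+ P := by
  obtain ⟨l1, l2, rfl, h1, h2⟩ := sublist_append_iff.1 h
  cases l2 with
  | nil => simpa using h1
  | cons a l2 => exact absurd (h2.subset (by simp)) (hQ a (by simp))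

lemma sublist_of_forall_notMem_left {α : Type*} {l P Q : List α} (h : l <+ P ++ Q)
    (hP : ∀ x ∈ l, x ∉ P) : l <+ Q := by
  obtain ⟨l1, l2, rfl, h1, h2⟩ := sublist_append_iff.1 h
  cases l1 with
  | nil => simpa using h2
  | cons a l1 => exact absurd (h1.subset (by simp)) (hP a (by simp))

/-- The entries of `X` other than `0` are `1, …, c - 1`, and every prefix of `X` has at most as
many entries `0` as other entries. -/
structure LeftShape (c : ℕ) (X : List ℕ) : Prop where
  filter_eq : X.filter (· ≠ 0) = range' 1 (c - 1)
  count_le : ∀ X1 X2, X = X1 ++ X2 → count 0 X1 ≤ (X1.filter (· ≠ 0)).length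

/-- The entries of `Z` other than `m = c + b - 1` are `c, …, m - 1`, and every suffix of `Z` has at
most as many entries `m` as other entries. -/
structure RightShape (c b : ℕ) (Z : List ℕ) : Prop where
  filter_eq : Z.filter (· ≠ c + b - 1) = range' c (b - 1)
  count_le : ∀ Z1 Z2, Z = Z1 ++ Z2 →
    count (c + b - 1) Z2 ≤ (Z2.filter (· ≠ c + b - 1)).length

lemma range'_eq_append_cons {s n j : ℕ} {A B : List ℕ} (h : A ++ j :: B = range' s n) :
    A = range' s (j - s) ∧ B = range' (j + 1) (s + n - (j + 1)) ∧ s ≤ j ∧ j < s + n := by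
  obtain ⟨k, hk, h1, h2⟩ := range'_eq_append_iff.1 h.symm
  obtain ⟨h3, h4, h5⟩ := (range'_eq_cons_iff).1 h2.symm
  refine ⟨by rw [h1]; congr; omega, ?_, by omega, by omega⟩
  rw [h5]
  congr 1; omega

/-- The nonzero letters before `j` are `1, …, j - 1`, and they bound the zeros there. -/
lemma LeftShape.count_lt (h : LeftShape c X) {X1 X2 : List ℕ} {j : ℕ} (e : X = X1 ++ j :: X2)
    (hj : j ≠ 0) : count 0 X1 < j := by
  have h1 := h.filter_eq
  rw [e, filter_append, filter_cons_of_pos (by simpa using hj)] at h1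
  have h2 := h.count_le X1 _ e
  rw [(range'_eq_append_cons h1).1, length_range'] at h2
  omega

lemma RightShape.count_lt (h : RightShape c b Z) {Z1 Z2 : List ℕ} {k : ℕ} (e : Z = Z1 ++ k :: Z2)
    (hk : k ≠ c + b - 1) : k + count (c + b - 1) Z2 < c + b - 1 := by
  have h1 := h.filter_eq
  rw [e, filter_append, filter_cons_of_pos (by simpa using hk)] at h1
  have h2 := h.count_le (Z1 ++ [k]) Z2 (by simp [e])
  obtain ⟨-, h3, h4, h5⟩ := range'_eq_append_cons h1
  rw [h3, length_range'] at h2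
  omega

lemma LeftShape.mem_iff (h : LeftShape c X) {k : ℕ} (hk : k ≠ 0) : k ∈ X ↔ k < c := by
  have : k ∈ X.filter (· ≠ 0) ↔ k ∈ X := by simp [hk]
  rw [← this, h.filter_eq, mem_range'_1]
  omega

lemma RightShape.mem_iff (h : RightShape c b Z) {k : ℕ} (hk : k ≠ c + b - 1) :
    k ∈ Z ↔ c ≤ k ∧ k < c + b - 1 := by
  have : k ∈ Z.filter (· ≠ c + b - 1) ↔ k ∈ Z := by simp [hk]
  rw [← this, h.filter_eq, mem_range'_1]
  omega

/-- A sorted subword consists of zeros followed by nonzero letters. If the latter begin with `j`,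
there are at most `j - 1` zeros before it and at most `c - j` nonzero letters from `j` on. -/
lemma LeftShape.length_lt (h : LeftShape c X) (h0 : count 0 X < c) {xs : List ℕ} (hs : xs <+ X)
    (hp : xs.Pairwise (· ≤ ·)) : xs.length < c := by
  by_cases hx : ∀ x ∈ xs, x = 0
  · have : xs = replicate xs.length 0 := eq_replicate_iff.2 ⟨rfl, hx⟩
    rw [this, replicate_sublist_iff] at hs
    omega
  · obtain ⟨u, j, t, rfl, hu, hj⟩ : ∃ u j t, xs = u ++ j :: t ∧ (∀ x ∈ u, x = 0) ∧ j ≠ 0 := by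
      clear hs hp
      induction xs with
      | nil => simp at hx
      | cons a xs ih =>
        by_cases ha : a = 0
        · obtain ⟨u, j, t, rfl, hu, hj⟩ := ih (by simpa [ha] using hx)
          exact ⟨a :: u, j, t, rfl, by simpa [ha] using hu, hj⟩
        · exact ⟨[], a, xs, rfl, by simp, ha⟩
    obtain ⟨P, Q, rfl, hP, hQ⟩ := exists_split_of_sublist hs
    have h1 := h.count_lt rfl hj
    have hu' : u = replicate u.length 0 := eq_replicate_iff.2 ⟨rfl, hu⟩
    rw [hu', replicate_sublist_iff] at hP
    have h2 := h.filter_eq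
    rw [filter_append, filter_cons_of_pos (by simpa using hj)] at h2
    obtain ⟨-, h3, h4, h5⟩ := range'_eq_append_cons h2
    have ht : ∀ x ∈ t, x ≠ 0 := by
      intro x hx
      have := (pairwise_cons.1 (pairwise_append.1 hp).2.1).1 x hx
      omega
    have h6 := (hQ.filter (· ≠ 0)).length_le
    rw [h3, filter_eq_self.2 (by simpa using ht), length_range'] at h6
    simp only [length_append, length_cons]
    omega

lemma RightShape.length_lt (h : RightShape c b Z) (h0 : count (c + b - 1) Z < b)
    (hZ : ∀ x ∈ Z, x ≤ c + b - 1) {zs : List ℕ} (hs : zs <+ Z)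
    (hp : zs.Pairwise (· ≤ ·)) : zs.length < b := by
  by_cases hx : ∀ x ∈ zs, x = c + b - 1
  · have : zs = replicate zs.length (c + b - 1) := eq_replicate_iff.2 ⟨rfl, hx⟩
    rw [this, replicate_sublist_iff] at hs
    omega
  · obtain ⟨t, j, u, rfl, hu, hj⟩ : ∃ t j u, zs = t ++ j :: u ∧ (∀ x ∈ u, x = c + b - 1) ∧
        j ≠ c + b - 1 := by
      clear hs hp
      induction zs using reverseRecOn with
      | nil => simp at hx
      | append_singleton zs a ih =>
        by_cases ha : a = c + b - 1
        · obtain ⟨t, j, u, rfl, hu, hj⟩ := ih (fun h => hx (by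
            intro x hx
            rcases mem_append.1 hx with hx | hx
            · exact h x hx
            · simp at hx; omega))
          refine ⟨t, j, u ++ [a], by simp, ?_, hj⟩
          intro x hx
          rcases mem_append.1 hx with hx | hx
          · exact hu x hx
          · simp at hx; omega
        · exact ⟨zs, a, [], rfl, by simp, ha⟩
    obtain ⟨P, Q, rfl, hP, hQ⟩ := exists_split_of_sublist hs
    have h1 := h.count_lt rfl hj
    have hu' : u = replicate u.length (c + b - 1) := eq_replicate_iff.2 ⟨rfl, hu⟩
    rw [hu', replicate_sublist_iff] at hQ
    have h2 := h.filter_eq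
    rw [filter_append, filter_cons_of_pos (by simpa using hj)] at h2
    obtain ⟨h3, -, h4, h5⟩ := range'_eq_append_cons h2
    have hjm : j ≤ c + b - 1 := hZ j (by simp)
    have ht : ∀ x ∈ t, x ≠ c + b - 1 := by
      intro x hx
      have := (pairwise_append.1 hp).2.2 x hx j (by simp)
      omega
    have h6 := (hP.filter (· ≠ c + b - 1)).length_le
    rw [h3, filter_eq_self.2 (by simpa using ht), length_range'] at h6
    simp only [length_append, length_cons]
    omega

/-- Blocks of letters `s, …, s + n - 1`, each repeated `k` times. -/
def blocks (s n k : ℕ) : List ℕ := (range' s n).flatMap (replicate k)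

lemma mem_blocks {s n k x : ℕ} : x ∈ blocks s n k ↔ (s ≤ x ∧ x < s + n) ∧ k ≠ 0 := by
  simp only [blocks, mem_flatMap, mem_range'_1, mem_replicate]
  constructor
  · rintro ⟨a, ha, hk, rfl⟩; exact ⟨ha, hk⟩
  · rintro ⟨ha, hk⟩; exact ⟨x, ha, hk, rfl⟩

lemma blocks_succ (s n k : ℕ) : blocks s (n + 1) k = replicate k s ++ blocks (s + 1) n k := by
  simp [blocks, range'_succ]

lemma pairwise_blocks (s n k : ℕ) : (blocks s n k).Pairwise (· ≤ ·) := by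
  induction n generalizing s with
  | zero => simp [blocks]
  | succ n ih =>
    rw [blocks_succ, pairwise_append]
    refine ⟨by simp [pairwise_replicate], ih _, fun x hx y hy => ?_⟩
    have := (mem_blocks.1 hy).1
    simp only [mem_replicate] at hx
    omega

lemma count_blocks (s n k x : ℕ) : count x (blocks s n k) = if s ≤ x ∧ x < s + n then k else 0 := by
  induction n generalizing s with
  | zero => simp [blocks]
  | succ n ih =>
    rw [blocks_succ, count_append, ih, count_replicate]
    simp only [beq_iff_eq]
    split_ifs <;> omega

/-- The increasing block of the letters `c, …, c + b - 1`. -/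
def upperBlock (c b κ : ℕ) : List ℕ := blocks c (b - 1) (κ - 1) ++ replicate (κ - (b - 1)) (c + b - 1)

/-- The increasing block of the letters `0, …, c - 1`. -/
def lowerBlock (c κ : ℕ) : List ℕ := replicate (κ - (c - 1)) 0 ++ blocks 1 (c - 1) (κ - 1)

lemma mem_upperBlock (hb : 1 ≤ b) (hκ : b + 1 ≤ κ) {x : ℕ} :
    x ∈ upperBlock c b κ ↔ c ≤ x ∧ x ≤ c + b - 1 := by
  simp only [upperBlock, mem_append, mem_blocks, mem_replicate]
  omega

lemma mem_lowerBlock (hc : 1 ≤ c) (hκ : c + 1 ≤ κ) {x : ℕ} : x ∈ lowerBlock c κ ↔ x < c := by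
  simp only [lowerBlock, mem_append, mem_blocks, mem_replicate]
  omega

lemma pairwise_upperBlock (c b κ : ℕ) : (upperBlock c b κ).Pairwise (· ≤ ·) := by
  rw [upperBlock, pairwise_append]
  refine ⟨pairwise_blocks _ _ _, by simp [pairwise_replicate], fun x hx y hy => ?_⟩
  have := (mem_blocks.1 hx).1
  simp only [mem_replicate] at hy
  omega

lemma pairwise_lowerBlock (c κ : ℕ) : (lowerBlock c κ).Pairwise (· ≤ ·) := by
  rw [lowerBlock, pairwise_append]
  refine ⟨by simp [pairwise_replicate], pairwise_blocks _ _ _, fun x hx y hy => ?_⟩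
  simp only [mem_replicate] at hx
  omega

/-- The three free parts of a good word all of whose letters are frequent. -/
structure Shape (c b : ℕ) (X Y Z : List ℕ) : Prop where
  left : LeftShape c X
  right : RightShape c b Z
  mem_mid : ∀ y ∈ Y, y = 0 ∨ y = c + b - 1
  count_zero : count 0 X + count 0 Y = c - 1
  count_top : count (c + b - 1) Y + count (c + b - 1) Z = b - 1

lemma triple_split {x y z : ℕ} (h : [x, y, z] <+ W) : ∃ P Q, W = P ++ y :: Q ∧ x ∈ P ∧ z ∈ Q := by
  obtain ⟨P, Q, e, hP, hQ⟩ := exists_split_of_sublist (xs := [x]) (v := y) (ys := [z]) h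
  exact ⟨P, Q, e, by simpa using hP, by simpa using hQ⟩

lemma pairwise_append_cons_of {xs ys : List ℕ} {v : ℕ} (hp : (xs ++ ys).Pairwise (· ≤ ·))
    (hr : ∀ y ∈ ys, v ≤ y) (hl : ∀ x ∈ xs, x ≤ v) : (xs ++ v :: ys).Pairwise (· ≤ ·) := by
  rw [pairwise_append] at hp ⊢
  refine ⟨hp.1, pairwise_cons.2 ⟨hr, hp.2.1⟩, fun x hx y hy => ?_⟩
  rcases mem_cons.1 hy with rfl | hy
  · exact hl x hx
  · exact hp.2.2 x hx y hy

/-- Since `y < x`, the letter `y` is not the top one, and the letters of `Z` below the top increase.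
-/
lemma RightShape.not_descent (h : RightShape c b Z) {P Q : List ℕ}
    {x y z : ℕ} (e : Z = P ++ y :: Q) (hz : z ∈ Q) (hzy : z < y) (hxy : y < x)
    (hx : x ≤ c + b - 1) : False := by
  have h1 := h.filter_eq
  rw [e, filter_append, filter_cons_of_pos (by simp; omega)] at h1
  obtain ⟨-, h2, -⟩ := range'_eq_append_cons h1
  have : z ∈ Q.filter (· ≠ c + b - 1) := by simp [hz]; omega
  rw [h2, mem_range'_1] at this
  omega

/-- Sorted subwords of `X` and of `Z` are too short to provide the `c` entries before `v` or the `b`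
entries after it. So `v` lies in `B`, `Y` or `A`, and any entry out of order with it would force the
entries on one side into `X` or `Z`, or into too few zeros or top letters. -/
lemma Shape.good (h : Shape c b X Y Z) (hc : 1 ≤ c) (hb : 1 ≤ b) {A B : List ℕ}
    (hB : B.Pairwise (· ≤ ·)) (hA : A.Pairwise (· ≤ ·)) (hB' : ∀ x ∈ B, c ≤ x ∧ x ≤ c + b - 1)
    (hA' : ∀ x ∈ A, x < c) : Good c b (X ++ (B ++ (Y ++ (A ++ Z)))) := by
  have hc0 := h.count_zero
  have hct := h.count_top
  have hX : ∀ x ∈ X, x < c := by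
    intro x hx
    by_cases hx0 : x = 0
    · omega
    · exact (h.left.mem_iff hx0).1 hx
  have hZ : ∀ x ∈ Z, c ≤ x ∧ x ≤ c + b - 1 := by
    intro x hx
    by_cases hx0 : x = c + b - 1
    · omega
    · have := (h.right.mem_iff hx0).1 hx
      omega
  have FX : ∀ xs, xs <+ X → xs.Pairwise (· ≤ ·) → xs.length < c := fun xs =>
    h.left.length_lt (by omega)
  have FZ : ∀ zs, zs <+ Z → zs.Pairwise (· ≤ ·) → zs.length < b := fun zs =>
    h.right.length_lt (by omega) fun x hx => (hZ x hx).2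
  constructor
  · intro x y z hs hxy hyz
    obtain ⟨P, Q, e, hxP, hzQ⟩ := triple_split hs
    rcases append_eq_append_cons e with ⟨X2, h1, h2⟩ | ⟨P, rfl, e1⟩
    · have h3 := h.left.filter_eq
      rw [h1, filter_append, filter_cons_of_pos (by simp; omega)] at h3
      obtain ⟨h4, -⟩ := range'_eq_append_cons h3
      have : x ∈ P.filter (· ≠ 0) := by simp [hxP]; omega
      rw [h4, mem_range'_1] at this
      omega
    rcases append_eq_append_cons e1 with ⟨B2, h1, h2⟩ | ⟨P, rfl, e2⟩
    · have hy := hB' y (by simp [h1])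
      rcases mem_append.1 hxP with hx | hx
      · have := hX x hx; omega
      · rw [h1] at hB
        have := (pairwise_append.1 hB).2.2 x hx y (by simp)
        omega
    rcases append_eq_append_cons e2 with ⟨Y2, h1, h2⟩ | ⟨P, rfl, e3⟩
    · have hy := h.mem_mid y (by simp [h1])
      have hx : x ≤ c + b - 1 := by
        simp only [mem_append] at hxP
        rcases hxP with hx | hx | hx
        · have := hX x hx; omega
        · exact (hB' x hx).2
        · have := h.mem_mid x (by simp [h1, hx]); omega
      omega
    rcases append_eq_append_cons e3 with ⟨A2, h1, h2⟩ | ⟨P, rfl, e4⟩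
    · have hy := hA' y (by simp [h1])
      rw [h2, mem_append] at hzQ
      rcases hzQ with hz | hz
      · rw [h1] at hA
        have := (pairwise_cons.1 (pairwise_append.1 hA).2.1).1 z hz
        omega
      · have := hZ z hz; omega
    · refine h.right.not_descent e4 hzQ hyz hxy ?_
      simp only [mem_append] at hxP
      rcases hxP with hx | hx | hx | hx | hx
      · have := hX x hx; omega
      · exact (hB' x hx).2
      · have := h.mem_mid x hx; omega
      · have := hA' x hx; omega
      · exact (hZ x (by simp [e4, hx])).2
  · intro xs v ys hs hxl hyl hp
    obtain ⟨P, Q, e, hxP, hyQ⟩ := exists_split_of_sublist hs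
    have hpx := (pairwise_append.1 hp).1
    have hpy := (pairwise_append.1 hp).2.1
    have hpxy := (pairwise_append.1 hp).2.2
    rcases append_eq_append_cons e with ⟨X2, h1, h2⟩ | ⟨P, rfl, e1⟩
    · have := FX xs (hxP.trans (h1 ▸ sublist_append_left _ _)) hpx
      omega
    -- `v` in `B`: consider a smaller later entry and the first entry `h0` of `ys`. If `h0 < c`, all
    -- of `xs` is below `c` and lies in `X`. Otherwise `c ≤ h0 < v`, so `h0`, and with it `ys`, lies
    -- in `Z`.
    rcases append_eq_append_cons e1 with ⟨B2, h1, h2⟩ | ⟨P, rfl, e2⟩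
    · rw [h1] at hB
      apply pairwise_append_cons_of hp
      · intro y hy
        by_contra! hlt
        have hv := hB' v (by simp [h1])
        cases ys with
        | nil => simp at hyl; omega
        | cons h0 ys =>
          have hh0 : h0 ≤ y := by
            rcases mem_cons.1 hy with rfl | hy
            · rfl
            · exact (pairwise_cons.1 hpy).1 y hy
          by_cases hhc : h0 < c
          · have := FX xs (sublist_of_forall_notMem_right hxP fun x hx hxP => by
              have := hpxy x hx h0 (by simp)
              have := hB' x (by simp [h1, hxP])
              omega) hpx
            omega
          · have h3 : h0 :: ys <+ Z := by
              rw [h2, ← append_assoc, ← append_assoc] at hyQ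
              obtain ⟨l1, l2, h4, h5, h6⟩ := sublist_append_iff.1 hyQ
              cases l1 with
              | nil => rw [h4]; simpa using h6
              | cons a l1 =>
                simp only [cons_append, cons.injEq] at h4
                have : h0 ∈ B2 ++ Y ++ A := h5.subset (by simp [h4.1])
                simp only [mem_append] at this
                rcases this with (hm | hm) | hm
                · have := (pairwise_cons.1 (pairwise_append.1 hB).2.1).1 h0 hm
                  omega
                · have := h.mem_mid h0 hm
                  omega
                · have := hA' h0 hm
                  omega
            have := FZ _ h3 hpy
            omega
      · intro x hx
        rcases mem_append.1 (hxP.subset hx) with hm | hm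
        · have := hX x hm
          have := hB' v (by simp [h1])
          omega
        · exact (pairwise_append.1 hB).2.2 x hm v (by simp)
    rcases append_eq_append_cons e2 with ⟨Y2, h1, h2⟩ | ⟨P, rfl, e3⟩
    · have hv := h.mem_mid v (by simp [h1])
      apply pairwise_append_cons_of hp
      · intro y hy
        by_contra! hlt
        have hv : v = c + b - 1 := by omega
        cases ys with
        | nil => simp at hyl; omega
        | cons h0 ys =>
          have hh0 : h0 ≤ y := by
            rcases mem_cons.1 hy with rfl | hy
            · rfl
            · exact (pairwise_cons.1 hpy).1 y hy
          by_cases hhc : h0 < c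
          -- Here `xs` stays below `c`. If it reaches into `Y` it meets a `0` there and so is
          -- constantly `0`; but `X` and `Y` together have only `c - 1` zeros.
          · have hxc : ∀ x ∈ xs, x ≤ h0 := fun x hx => hpxy x hx h0 (by simp)
            obtain ⟨l1, l2, rfl, h3, h4⟩ := sublist_append_iff.1 hxP
            have h5 : l2 <+ P := sublist_of_forall_notMem_left h4 fun x hx hxP => by
              have := hxc x (by simp [hx])
              have := hB' x hxP
              omega
            cases l2 with
            | nil =>
              have := FX l1 h3 (by simpa using hpx)
              simp at hxl
              omega
            | cons a l2 =>
              have ha := h.mem_mid a (by rw [h1]; exact mem_append_left _ (h5.subset (by simp)))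
              have ha' := hxc a (by simp)
              have z1 : ∀ x ∈ l1, x = 0 := fun x hx => by
                have := (pairwise_append.1 hpx).2.2 x hx a (by simp)
                omega
              have z2 : ∀ x ∈ a :: l2, x = 0 := fun x hx => by
                have := hxc x (by simp only [mem_append]; exact Or.inr hx)
                have := h.mem_mid x (by rw [h1]; exact mem_append_left _ (h5.subset hx))
                omega
              have e1 := h3.count_le 0
              have e2 := h5.count_le 0
              rw [count_eq_length.2 fun x hx => (z1 x hx).symm] at e1
              rw [count_eq_length.2 fun x hx => (z2 x hx).symm] at e2
              rw [h1, count_append] at hc0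
              rw [length_append] at hxl
              omega
          · have h3 : h0 :: ys <+ Z := by
              rw [h2, ← append_assoc] at hyQ
              obtain ⟨l1, l2, h4, h5, h6⟩ := sublist_append_iff.1 hyQ
              cases l1 with
              | nil => rw [h4]; simpa using h6
              | cons a l1 =>
                simp only [cons_append, cons.injEq] at h4
                have : h0 ∈ Y2 ++ A := h5.subset (by simp [h4.1])
                simp only [mem_append] at this
                rcases this with hm | hm
                · have := h.mem_mid h0 (by simp [h1, hm])
                  omega
                · have := hA' h0 hm
                  omega
            have := FZ _ h3 hpy
            omega
      -- An earlier larger entry forces `v = 0`; the argument is the mirror image, with the last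
      -- entry `l0` of `xs` and the `b - 1` top letters of `Y` and `Z`.
      · intro x hx
        by_contra! hlt
        obtain ⟨l, l0, rfl⟩ : ∃ l l0, xs = l ++ [l0] := by
          rcases eq_nil_or_concat xs with rfl | ⟨l, l0, rfl⟩
          · simp at hx
          · exact ⟨l, l0, by simp⟩
        have hl0 : x ≤ l0 := by
          rcases mem_append.1 hx with hx | hx
          · exact (pairwise_append.1 hpx).2.2 x hx l0 (by simp)
          · simp at hx; omega
        by_cases hhc : l0 < c
        · have h3 : l ++ [l0] <+ X := by
            obtain ⟨l1, l2, h4, h5, h6⟩ := sublist_append_iff.1 hxP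
            rcases eq_nil_or_concat l2 with rfl | ⟨l2, a, rfl⟩
            · rw [h4]; simpa using h5
            · rw [concat_eq_append, ← append_assoc] at h4
              obtain ⟨-, h7⟩ := append_inj' h4 rfl
              have : l0 ∈ B ++ P := h6.subset (by simp_all)
              rcases mem_append.1 this with hm | hm
              · have := hB' l0 hm
                omega
              · have := h.mem_mid l0 (by simp [h1, hm])
                omega
          have := FX _ h3 hpx
          omega
        · have hyc : ∀ y ∈ ys, l0 ≤ y := fun y hy => hpxy l0 (by simp) y hy
          rw [h2] at hyQ
          obtain ⟨l1, l2, rfl, h3, h4⟩ := sublist_append_iff.1 hyQ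
          have h5 : l2 <+ Z := sublist_of_forall_notMem_left h4 fun x hx hxA => by
            have := hyc x (by simp [hx])
            have := hA' x hxA
            omega
          cases l1 with
          | nil =>
            have := FZ l2 h5 (by simpa using hpy)
            simp at hyl
            omega
          | cons a l1 =>
            have ha := h.mem_mid a (by rw [h1]; simp [h3.subset (show a ∈ a :: l1 by simp)])
            have ha' := hyc a (by simp)
            have z2 : ∀ x ∈ l2, x = c + b - 1 := fun x hx => by
              have := (pairwise_append.1 hpy).2.2 a (by simp) x hx
              have := hZ x (h5.subset hx)
              omega
            have z1 : ∀ x ∈ a :: l1, x = c + b - 1 := fun x hx => by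
              have := hyc x (by simp only [mem_append]; exact Or.inl hx)
              have := h.mem_mid x (by rw [h1]; simp [h3.subset hx])
              omega
            have e1 := h3.count_le (c + b - 1)
            have e2 := h5.count_le (c + b - 1)
            rw [count_eq_length.2 fun x hx => (z1 x hx).symm] at e1
            rw [count_eq_length.2 fun x hx => (z2 x hx).symm] at e2
            rw [h1, count_append, count_cons] at hct
            rw [length_append] at hyl
            omega
    rcases append_eq_append_cons e3 with ⟨A2, h1, h2⟩ | ⟨P, rfl, e4⟩
    · rw [h1] at hA
      have hv := hA' v (by simp [h1])
      apply pairwise_append_cons_of hp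
      · intro y hy
        have := hyQ.subset hy
        rw [h2, mem_append] at this
        rcases this with hm | hm
        · exact (pairwise_cons.1 (pairwise_append.1 hA).2.1).1 y hm
        · have := hZ y hm
          omega
      · intro x hx
        by_contra! hlt
        obtain ⟨l, l0, rfl⟩ : ∃ l l0, xs = l ++ [l0] := by
          rcases eq_nil_or_concat xs with rfl | ⟨l, l0, rfl⟩
          · simp at hx
          · exact ⟨l, l0, by simp⟩
        have hl0 : x ≤ l0 := by
          rcases mem_append.1 hx with hx | hx
          · exact (pairwise_append.1 hpx).2.2 x hx l0 (by simp)
          · simp at hx; omega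
        by_cases hhc : l0 < c
        · have h3 : l ++ [l0] <+ X := by
            obtain ⟨l1, l2, h4, h5, h6⟩ := sublist_append_iff.1 hxP
            rcases eq_nil_or_concat l2 with rfl | ⟨l2, a, rfl⟩
            · rw [h4]; simpa using h5
            · rw [concat_eq_append, ← append_assoc] at h4
              obtain ⟨-, h7⟩ := append_inj' h4 rfl
              have : l0 ∈ B ++ (Y ++ P) := h6.subset (by simp_all)
              simp only [mem_append] at this
              rcases this with hm | hm | hm
              · have := hB' l0 hm
                omega
              · have := h.mem_mid l0 hm
                omega
              · have := (pairwise_append.1 hA).2.2 l0 hm v (by simp)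
                omega
          have := FX _ h3 hpx
          omega
        · have := FZ ys (by
            rw [h2] at hyQ
            exact sublist_of_forall_notMem_left hyQ fun y hy hyA => by
              have := hpxy l0 (by simp) y hy
              have := hA' y (by simp [h1, hyA])
              omega) hpy
          omega
    · have := FZ ys (hyQ.trans (e4 ▸ (sublist_cons_self _ _).trans (sublist_append_right _ _))) hpy
      omega

lemma RightShape.good (h : RightShape 0 b Z) (h0 : count (0 + b - 1) Z < b)
    {B : List ℕ} (hB : B.Pairwise (· ≤ ·)) (hB' : ∀ x ∈ B, x ≤ 0 + b - 1) : Good 0 b (B ++ Z) := by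
  have hZ : ∀ x ∈ Z, x ≤ 0 + b - 1 := by
    intro x hx
    by_cases hx0 : x = 0 + b - 1
    · omega
    · have := (h.mem_iff hx0).1 hx
      omega
  constructor
  · intro x y z hs hxy hyz
    obtain ⟨P, Q, e, hxP, hzQ⟩ := triple_split hs
    rcases append_eq_append_cons e with ⟨B2, h1, h2⟩ | ⟨P, rfl, e1⟩
    · rw [h1] at hB
      have := (pairwise_append.1 hB).2.2 x hxP y (by simp)
      omega
    · refine h.not_descent e1 hzQ hyz hxy ?_
      rcases mem_append.1 hxP with hx | hx
      · exact hB' x hx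
      · exact hZ x (by simp [e1, hx])
  · intro xs v ys hs hxl hyl hp
    obtain ⟨P, Q, e, hxP, hyQ⟩ := exists_split_of_sublist hs
    rw [length_eq_zero_iff] at hxl
    subst hxl
    rw [nil_append] at hp
    rcases append_eq_append_cons e with ⟨B2, h1, h2⟩ | ⟨P, rfl, e1⟩
    · rw [nil_append, pairwise_cons]
      refine ⟨fun y hy => ?_, hp⟩
      by_contra! hlt
      rw [h2] at hyQ
      obtain ⟨l1, l2, rfl, h5, h6⟩ := sublist_append_iff.1 hyQ
      cases l1 with
      | nil =>
        have := h.length_lt h0 hZ h6 (by simpa using hp)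
        simp at hyl
        omega
      | cons a l1 =>
        rw [h1] at hB
        have h3 := (pairwise_cons.1 (pairwise_append.1 hB).2.1).1 a (h5.subset (by simp))
        have h4 : a ≤ y := by
          rw [cons_append] at hy
          rcases mem_cons.1 hy with rfl | hy
          · rfl
          · exact (pairwise_cons.1 hp).1 y hy
        omega
    · have := h.length_lt h0 hZ
        (hyQ.trans (e1 ▸ (sublist_cons_self _ _).trans (sublist_append_right _ _))) hp
      omega

end PermPattern

/-! ### Reverse complement -/

namespace PermPattern

open List

variable {c b κ m : ℕ} {W X Y Z : List ℕ}

/-- The reverse complement of a word over the letters `0, …, m`. -/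
def rc (m : ℕ) (W : List ℕ) : List ℕ := (W.map (m - ·)).reverse

@[simp] lemma rc_nil : rc m [] = [] := rfl

@[simp] lemma rc_append (A B : List ℕ) : rc m (A ++ B) = rc m B ++ rc m A := by simp [rc]

@[simp] lemma rc_cons (x : ℕ) (A : List ℕ) : rc m (x :: A) = rc m A ++ [m - x] := by simp [rc]

@[simp] lemma length_rc (A : List ℕ) : (rc m A).length = A.length := by simp [rc]

@[simp] lemma rc_replicate (n x : ℕ) : rc m (replicate n x) = replicate n (m - x) := by simp [rc]

lemma le_of_mem_rc {x : ℕ} (h : x ∈ rc m W) : x ≤ m := by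
  simp only [rc, mem_reverse, mem_map] at h
  obtain ⟨y, -, rfl⟩ := h
  omega

lemma mem_rc {x : ℕ} (hW : ∀ x ∈ W, x ≤ m) (hx : x ≤ m) : x ∈ rc m W ↔ m - x ∈ W := by
  simp only [rc, mem_reverse, mem_map]
  constructor
  · rintro ⟨y, hy, rfl⟩
    rwa [Nat.sub_sub_self (hW y hy)]
  · exact fun h => ⟨_, h, Nat.sub_sub_self hx⟩

lemma rc_rc (hW : ∀ x ∈ W, x ≤ m) : rc m (rc m W) = W := by
  simp only [rc, map_reverse, reverse_reverse, map_map]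
  conv_rhs => rw [← map_id W]
  exact map_congr_left fun x hx => by have := hW x hx; simp; omega

lemma count_rc (hW : ∀ x ∈ W, x ≤ m) {k : ℕ} (hk : k ≤ m) : count k (rc m W) = count (m - k) W := by
  induction W with
  | nil => simp
  | cons a W ih =>
    have ha := hW a (by simp)
    rw [rc_cons, count_append, ih fun x hx => hW x (by simp [hx]), count_singleton, count_cons]
    congr 1
    simp only [beq_iff_eq]
    split_ifs <;> omega

lemma sublist_rc {A B : List ℕ} (h : A <+ B) : rc m A <+ rc m B := reverse_sublist.2 (h.map _)

lemma pairwise_rc {A : List ℕ} (h : A.Pairwise (· ≤ ·)) : (rc m A).Pairwise (· ≤ ·) := by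
  rw [rc, pairwise_reverse, pairwise_map]
  exact h.imp fun h => by omega

/-- Reversing the word and complementing the letters together preserve sortedness and decreasing
triples, while entry number `c` of `c + b + 1` becomes entry number `b`. -/
lemma Good.rc (h : Good c b W) (hW : ∀ x ∈ W, x ≤ m) : Good b c (rc m W) := by
  have back : ∀ {A}, A <+ PermPattern.rc m W → PermPattern.rc m A <+ W ∧ ∀ x ∈ A, x ≤ m := fun hA =>
    ⟨by simpa only [rc_rc hW] using sublist_rc (m := m) hA, fun x hx => le_of_mem_rc (hA.subset hx)⟩
  constructor
  · intro x y z hs hxy hyz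
    obtain ⟨h1, h2⟩ := back hs
    have hx := h2 x (by simp)
    have hy := h2 y (by simp)
    exact h.1 (m - z) (m - y) (m - x) (by simpa using h1) (by omega) (by omega)
  · intro xs v ys hs hx hy hp
    obtain ⟨h1, h2⟩ := back hs
    have h3 := h.2 (PermPattern.rc m ys) (m - v) (PermPattern.rc m xs) (by simpa using h1) (by simpa)
      (by simpa) (by rw [← rc_append]; exact pairwise_rc hp)
    rw [← rc_rc h2]
    exact pairwise_rc (by simpa using h3)

lemma Proper.rc (h : Proper m W) : Proper m (rc m W) := by
  refine ⟨fun x hx => le_of_mem_rc hx, fun i hi => ?_⟩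
  have := sublist_rc (m := m) (h.2 (m - i - 1) (by omega))
  simp only [rc_cons, rc_nil, nil_append, singleton_append] at this
  rwa [show m - (m - i - 1) = i + 1 by omega, show m - (m - i - 1 + 1) = i by omega] at this

lemma ncard_goodWords_rc (c b m κ : ℕ) :
    (goodWords c b m fun _ => κ).ncard = (goodWords b c m fun _ => κ).ncard := by
  have key : ∀ {c b W}, W ∈ goodWords c b m (fun _ => κ) → rc m W ∈ goodWords b c m fun _ => κ := by
    rintro c b W ⟨h1, h2, h3⟩
    refine ⟨h1.rc h2.1, h2.rc, fun k => ?_⟩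
    rw [count_rc h2.1 (by omega)]
    exact h3 ⟨m - k, by omega⟩
  refine Set.ncard_congr (fun W _ => rc m W) (fun W hW => key hW) ?_
    fun W hW => ⟨rc m W, key hW, rc_rc hW.2.1.1⟩
  intro W W' hW hW' h
  rw [← rc_rc hW.2.1.1, h, rc_rc hW'.2.1.1]

lemma eq_of_count_eq {A B : List ℕ} (hA : A.Pairwise (· ≤ ·)) (hB : B.Pairwise (· ≤ ·))
    (h : ∀ k, count k A = count k B) : A = B :=
  (perm_iff_count.2 h).eq_of_pairwise (fun _ _ _ _ h1 h2 => le_antisymm h1 h2) hA hB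

/-! ### Frequent letters force the shape -/

/-- A letter `x ≥ c` is at most each later letter that has `b` occurrences of `m` to its right. -/
lemma Good.le_of_replicate_after (h : Good c b W) (hd : Proper (c + b - 1) W) (hb : 1 ≤ b)
    {P Q : List ℕ} {x y : ℕ} (hW : W = P ++ x :: Q) (hx : c ≤ x)
    (hs : y :: replicate b (c + b - 1) <+ Q) : x ≤ y := by
  have hxm : x ≤ c + b - 1 := hd.1 x (by simp [hW])
  have hym : y ≤ c + b - 1 := hd.1 y (by
    rw [hW]; exact mem_append_right _ (mem_cons_of_mem _ (hs.subset (by simp))))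
  rcases Nat.eq_zero_or_pos c with rfl | hc
  · refine h.le_right (xs := []) (v := x) (ys := y :: replicate (b - 1) (0 + b - 1)) ?_ rfl
      (by simp; omega) (by simp [pairwise_replicate]; omega) y (by simp)
    rw [hW]
    refine Sublist.trans ?_ (sublist_append_right _ _)
    exact (Sublist.trans (((replicate_sublist_replicate _).2 (by omega)).cons_cons _) hs).cons_cons _
  · obtain ⟨x, rfl⟩ : ∃ x', x = x' + 1 := ⟨x - 1, by omega⟩
    have h1 := h.range'_sublist_before hd hW
    -- In terms of the original letter, now `x + 1`, these are the `c - 1` letters just below it.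
    -- With that letter they form `c` sorted entries before `y`; the letters `m` after `y` supply
    -- the other `b`.
    have h2 : range' (x + 2 - c) (c - 1) <+ range' 1 x := by
      have : range' 1 x = range' 1 (x + 1 - c) ++ range' (x + 2 - c) (c - 1) := by
        rw [show x + 2 - c = 1 + (x + 1 - c) by omega, range'_append_1]
        congr 1; omega
      rw [this]
      exact sublist_append_right _ _
    refine h.le_left (xs := range' (x + 2 - c) (c - 1) ++ [x + 1]) (v := y)
      (ys := replicate b (c + b - 1)) ?_ (by simp; omega) (by simp) ?_ (x + 1) (by simp)
    · rw [hW, append_assoc]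
      exact (h2.trans h1).append (hs.cons_cons _)
    · simp only [pairwise_append, pairwise_replicate, pairwise_singleton, pairwise_le_range',
        mem_append, mem_range'_1, mem_singleton, mem_replicate]
      refine ⟨⟨trivial, trivial, ?_⟩, ?_, ?_⟩
      all_goals omega

/-- Every letter before a letter `y < c` which has `c` letters `0` to its left is at most `y`. -/
lemma Good.le_of_replicate_before (h : Good c b W) (hd : Proper (c + b - 1) W) (hc : 1 ≤ c)
    {P Q : List ℕ} {x y : ℕ} (hW : W = P ++ y :: Q) (hy : y < c)
    (hs : replicate c 0 ++ [x] <+ P) : x ≤ y := by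
  have hxm : x ≤ c + b - 1 := hd.1 x (by
    rw [hW]; exact mem_append_left _ (hs.subset (by simp)))
  have h1 := (h.rc hd.1).le_of_replicate_after (P := PermPattern.rc (c + b - 1) Q)
    (Q := PermPattern.rc (c + b - 1) P) (x := c + b - 1 - y) (y := c + b - 1 - x)
    (by rw [add_comm b c]; exact hd.rc) hc (by rw [hW]; simp) (by omega) (by
      have := sublist_rc (m := c + b - 1) hs
      simpa [add_comm b c] using this)
  omega

lemma exists_split_of_lt_count {α : Type*} [DecidableEq α] {k : α} {W : List α} {j : ℕ}
    (h : j < count k W) : ∃ P R, W = P ++ k :: R ∧ count k P = j := by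
  obtain ⟨P, R, rfl, hP⟩ := exists_append_of_le_count h.le
  rw [count_append] at h
  obtain ⟨A, B, rfl, hA⟩ := eq_append_cons_of_mem (count_pos_iff.1 (show 0 < count k R by omega))
  exact ⟨P ++ A, B, by simp, by rw [count_append, hP, count_eq_zero.2 hA, add_zero]⟩

/-- The letter `m` before `Z` does the work: a descent among the smaller letters of `Z` would
complete a decreasing triple, and `1, …, c, m` followed by `b` sorted letters of `Z` starting below
`m` would violate goodness. Each `k` with `c ≤ k < m` must occur in `Z`, since properness asks for a
`k` after a `k + 1` and `F`, `m`, `S` do not provide it. -/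
lemma Good.rightShape (h : Good c b W) (hd : Proper (c + b - 1) W) {F S : List ℕ}
    (hW : W = F ++ (c + b - 1) :: (S ++ Z)) (hF : ∀ k, c ≤ k → ¬ [k + 1, k] <+ F)
    (hS : ∀ k ∈ S, c ≤ k → c + b - 1 ≤ k) (hZ : ∀ z ∈ Z, c ≤ z)
    (hc : count (c + b - 1) Z ≤ b - 1) : RightShape c b Z := by
  have hZm : ∀ z ∈ Z, z ≤ c + b - 1 := fun z hz => hd.1 z (by simp [hW, hz])
  have chain : ∀ ys, ys <+ Z → ys.Pairwise (· ≤ ·) → (∃ y ∈ ys, y < c + b - 1) →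
      ys.length < b := by
    rintro ys hs hp ⟨y, hy, hym⟩
    by_contra! hle
    cases ys with
    | nil => simp at hy
    | cons y0 ys =>
      have h0 : y0 < c + b - 1 := by
        rcases mem_cons.1 hy with rfl | hy
        · exact hym
        · exact ((pairwise_cons.1 hp).1 y hy).trans_lt hym
      have hcy := hZ y0 (hs.subset (by simp))
      have h1 := h.range'_sublist_before hd (v := c + b - 1 - 1) (P := F) (Q := S ++ Z) (by
        rw [hW, Nat.sub_add_cancel (by omega)])
      have h2 : range' 1 c <+ F := (range'_sublist_right.2 (by omega)).trans h1
      have hs' : take b (y0 :: ys) <+ Z := (take_sublist _ _).trans hs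
      have := h.le_right (xs := range' 1 c) (v := c + b - 1) (ys := take b (y0 :: ys)) (by
          rw [hW]
          exact h2.append ((hs'.trans (sublist_append_right _ _)).cons_cons _)) (by simp)
        (by rw [length_take]; omega) (by
          rw [pairwise_append]
          refine ⟨pairwise_le_range', hp.sublist (take_sublist _ _), fun x hx y hy => ?_⟩
          have := hZ y (hs'.subset hy)
          rw [mem_range'_1] at hx
          omega) y0 (by
          obtain ⟨b, rfl⟩ : ∃ b', b = b' + 1 := ⟨b - 1, by omega⟩
          simp)
      omega
  set T := Z.filter (· ≠ c + b - 1) with hT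
  have hTZ : T <+ Z := filter_sublist
  have hTm : ∀ x ∈ T, x < c + b - 1 := fun x hx => by
    have h1 := hZm x (hTZ.subset hx)
    simp only [hT, mem_filter, decide_eq_true_eq] at hx
    omega
  have hTs : T.Pairwise (· ≤ ·) := by
    rw [pairwise_iff_forall_sublist]
    intro x y hs
    by_contra! hlt
    refine h.1 (c + b - 1) x y ?_ (hTm x (hs.subset (by simp))) hlt
    rw [hW]
    exact (((hs.trans hTZ).trans (sublist_append_right _ _)).cons_cons _).trans
      (sublist_append_right _ _)
  have hmem : range' c (b - 1) ⊆ T := by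
    intro k hk
    rw [mem_range'_1] at hk
    simp only [hT, mem_filter, decide_eq_true_eq]
    refine ⟨?_, by omega⟩
    by_contra hkZ
    have h1 := hd.2 k (by omega)
    rw [hW, ← cons_append, ← append_assoc] at h1
    refine hF k hk.1 (pair_sublist_left (pair_sublist_left h1 hkZ) ?_)
    rw [mem_cons, not_or]
    exact ⟨by omega, fun hkS => by have := hS k hkS hk.1; omega⟩
  have hTl : T.length ≤ b - 1 := by
    cases e : T with
    | nil => simp
    | cons x T' =>
      have := chain T hTZ hTs ⟨x, by simp [e], hTm x (by simp [e])⟩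
      rw [e] at this
      omega
  have hfe : T = range' c (b - 1) :=
    ((subperm_of_subset nodup_range' hmem).perm_of_length_le (by simpa using hTl)).symm.eq_of_pairwise
      (fun _ _ _ _ h1 h2 => le_antisymm h1 h2) hTs pairwise_le_range'
  refine ⟨hfe, ?_⟩
  rintro Z1 Z2 rfl
  have hl : (Z1.filter (· ≠ c + b - 1)).length + (Z2.filter (· ≠ c + b - 1)).length = b - 1 := by
    rw [← length_append, ← filter_append, ← hT, hfe, length_range']
  rw [count_append] at hc
  cases e : Z1.filter (· ≠ c + b - 1) with
  | nil => rw [e] at hl; simp only [length_nil] at hl; omega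
  | cons x T1 =>
    have hlt : ∀ y ∈ Z1.filter (· ≠ c + b - 1), y < c + b - 1 := fun y hy =>
      hTm y (by rw [hT, filter_append]; exact mem_append_left _ hy)
    -- The small letters of `Z1` followed by the top letters of `Z2` form a sorted subword, hence
    -- have total length below `b`. This is the suffix inequality.
    have := chain (Z1.filter (· ≠ c + b - 1) ++ replicate (count (c + b - 1) Z2) (c + b - 1))
      (filter_sublist.append (replicate_sublist_iff.2 le_rfl)) (by
        rw [pairwise_append]
        refine ⟨hTs.sublist ?_, by simp [pairwise_replicate], fun y hy z hz => ?_⟩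
        · rw [hT, filter_append]
          exact sublist_append_left _ _
        · rw [(mem_replicate.1 hz).2]
          exact (hlt y hy).le)
      ⟨x, mem_append_left _ (e ▸ mem_cons_self), hlt x (e ▸ mem_cons_self)⟩
    simp only [length_append, length_replicate] at this
    omega

lemma filter_rc (hX : ∀ x ∈ X, x ≤ m) : (rc m X).filter (· ≠ m) = rc m (X.filter (· ≠ 0)) := by
  induction X with
  | nil => simp
  | cons a X ih =>
    have ha := hX a (by simp)
    rw [rc_cons, filter_append, ih fun x hx => hX x (by simp [hx])]
    rcases Nat.eq_zero_or_pos a with rfl | h0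
    · simp
    · have h1 : m - a ≠ m := by omega
      have h2 : a ≠ 0 := by omega
      simp [h1, h2]

lemma rc_range' {s n s' : ℕ} (h : s + n + s' = m + 1) : rc m (range' s n) = range' s' n := by
  refine ext_getElem (by simp) fun i h1 h2 => ?_
  simp only [length_range'] at h2
  simp [rc]
  omega

lemma RightShape.leftShape (hX : ∀ x ∈ X, x ≤ c + b - 1) (hc : 1 ≤ c)
    (h : RightShape b c (rc (c + b - 1) X)) : LeftShape c X := by
  have e : b + c - 1 = c + b - 1 := by omega
  have hf : ∀ {A}, A <+ X → ∀ x ∈ A, x ≤ c + b - 1 := fun hA x hx => hX x (hA.subset hx)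
  obtain ⟨h1, h2⟩ := h
  rw [e] at h1
  simp only [e] at h2
  rw [filter_rc hX] at h1
  constructor
  · rw [← rc_rc (hf filter_sublist), h1]
    exact rc_range' (by omega)
  · rintro X1 X2 rfl
    have h3 := h2 (rc (c + b - 1) X2) (rc (c + b - 1) X1) (by simp)
    rwa [count_rc (hf (sublist_append_left _ _)) le_rfl, Nat.sub_self,
      filter_rc (hf (sublist_append_left _ _)), length_rc] at h3

/-- After the first letter `≥ c` no letter `< c` can follow, and the rest is sorted. -/
lemma exists_sorted_suffix {F : List ℕ}
    (h : ∀ P x Q, F = P ++ x :: Q → c ≤ x → ∀ y ∈ Q, x ≤ y) :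
    ∃ X B, F = X ++ B ∧ (∀ x ∈ X, x < c) ∧ (∀ x ∈ B, c ≤ x) ∧ B.Pairwise (· ≤ ·) := by
  induction F with
  | nil => exact ⟨[], [], by simp⟩
  | cons a F ih =>
    by_cases ha : a < c
    · obtain ⟨X, B, rfl, h1, h2, h3⟩ := ih fun P x Q e => h (a :: P) x Q (by simp [e])
      exact ⟨a :: X, B, rfl, by simpa [ha] using h1, h2, h3⟩
    · have hB : ∀ x ∈ a :: F, c ≤ x := fun x hx => by
        rcases mem_cons.1 hx with rfl | hx
        · omega
        · have := h [] a F rfl (by omega) x hx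
          omega
      refine ⟨[], a :: F, rfl, by simp, hB, ?_⟩
      rw [pairwise_iff_forall_sublist]
      intro x y hs
      obtain ⟨P, Q, e, -, hQ⟩ := exists_split_of_sublist (xs := []) (v := x) (ys := [y]) hs
      exact h P x Q e (hB x (hs.subset (by simp))) y (singleton_sublist.1 hQ)

lemma Good.exists_sorted_suffix (h : Good c b W) (hd : Proper (c + b - 1) W) (hb : 1 ≤ b)
    {F V : List ℕ} (hW : W = F ++ (c + b - 1) :: V) (hV : count (c + b - 1) V = b) :
    ∃ X B, F = X ++ B ∧ (∀ x ∈ X, x < c) ∧ (∀ x ∈ B, c ≤ x) ∧ B.Pairwise (· ≤ ·) := by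
  refine PermPattern.exists_sorted_suffix fun P x Q e hx y hy => ?_
  refine h.le_of_replicate_after hd hb (P := P) (Q := Q ++ (c + b - 1) :: V) (by simp [hW, e]) hx ?_
  have h1 : [y] <+ Q := singleton_sublist.2 hy
  exact h1.append ((replicate_sublist_iff.2 hV.ge).trans (sublist_cons_self _ _))

lemma LeftShape.count_eq (h : LeftShape c X) {k : ℕ} (hk : k ≠ 0) :
    count k X = if k < c then 1 else 0 := by
  rw [← count_filter (p := (· ≠ 0)) (by simpa using hk), h.filter_eq, Nodup.count nodup_range']
  simp only [mem_range'_1]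
  refine if_congr ?_ rfl rfl
  omega

lemma RightShape.count_eq (h : RightShape c b Z) {k : ℕ} (hk : k ≠ c + b - 1) :
    count k Z = if c ≤ k ∧ k < c + b - 1 then 1 else 0 := by
  rw [← count_filter (p := (· ≠ c + b - 1)) (by simpa using hk), h.filter_eq,
    Nodup.count nodup_range']
  simp only [mem_range'_1]
  refine if_congr ?_ rfl rfl
  omega

lemma count_upperBlock (c b κ k : ℕ) : count k (upperBlock c b κ) =
    if c ≤ k ∧ k < c + (b - 1) then κ - 1 else if k = c + b - 1 then κ - (b - 1) else 0 := by
  simp only [upperBlock, count_append, count_blocks, count_replicate, beq_iff_eq]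
  split_ifs <;> omega

lemma count_lowerBlock (c κ k : ℕ) : count k (lowerBlock c κ) =
    if k = 0 then κ - (c - 1) else if k < c then κ - 1 else 0 := by
  simp only [lowerBlock, count_append, count_blocks, count_replicate, beq_iff_eq]
  split_ifs <;> omega

lemma Shape.mem_left (h : Shape c b X Y Z) (hc : 1 ≤ c) : ∀ x ∈ X, x < c := by
  intro x hx
  by_cases hx0 : x = 0
  · omega
  · exact (h.left.mem_iff hx0).1 hx

lemma Shape.mem_right (h : Shape c b X Y Z) (hb : 1 ≤ b) : ∀ x ∈ Z, c ≤ x ∧ x ≤ c + b - 1 := by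
  intro x hx
  by_cases hx0 : x = c + b - 1
  · omega
  · have := (h.right.mem_iff hx0).1 hx
    omega

/-- The good word with given free parts, each of whose letters occurs `κ` times. -/
def wordOfShape (c b κ : ℕ) (X Y Z : List ℕ) : List ℕ :=
  X ++ (upperBlock c b κ ++ (Y ++ (lowerBlock c κ ++ Z)))

lemma Shape.mem_goodWords (h : Shape c b X Y Z) (hc : 1 ≤ c) (hb : 1 ≤ b) (hκ : c + b + 1 ≤ κ) :
    wordOfShape c b κ X Y Z ∈ goodWords c b (c + b - 1) fun _ => κ := by
  have hX := h.mem_left hc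
  have hZ := h.mem_right hb
  have hB := fun x => mem_upperBlock (c := c) (κ := κ) (x := x) hb (by omega)
  have hA := fun x => mem_lowerBlock (κ := κ) (x := x) hc (by omega)
  refine ⟨h.good hc hb (pairwise_upperBlock _ _ _) (pairwise_lowerBlock _ _)
    (fun x hx => (hB x).1 hx) (fun x hx => (hA x).1 hx), ⟨?_, ?_⟩, ?_⟩
  · intro x hx
    simp only [wordOfShape, mem_append] at hx
    rcases hx with hx | hx | hx | hx | hx
    · have := hX x hx; omega
    · exact ((hB x).1 hx).2
    · have := h.mem_mid x hx; omega
    · have := (hA x).1 hx; omega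
    · exact (hZ x hx).2
  -- A pair `i + 1`, `i` is found with `i + 1` in `X` or the upper block and `i` in the lower block
  -- or `Z`.
  · intro i hi
    have s1 : ∀ {A B : List ℕ}, i + 1 ∈ A → i ∈ B → [i + 1, i] <+ A ++ B := fun h1 h2 =>
      (singleton_sublist.2 h1).append (singleton_sublist.2 h2)
    rw [wordOfShape]
    rcases lt_or_ge (i + 1) c with h1 | h1
    · exact s1 ((h.left.mem_iff (by omega)).2 h1)
        (by simp only [mem_append]; exact Or.inr (Or.inr (Or.inl ((hA i).2 (by omega)))))
    · refine (s1 ((hB _).2 (by omega)) ?_).trans (sublist_append_right _ _)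
      rcases lt_or_ge i c with h2 | h2
      · simp only [mem_append]; exact Or.inr (Or.inl ((hA i).2 h2))
      · simp only [mem_append]
        exact Or.inr (Or.inr ((h.right.mem_iff (by omega)).2 (by omega)))
  · intro k
    obtain ⟨k, hk⟩ := k
    have h0 := h.count_zero
    have h1 := h.count_top
    simp only [wordOfShape, count_append, count_upperBlock, count_lowerBlock]
    by_cases hk0 : k = 0
    · subst hk0
      rw [h.right.count_eq (by omega)]
      split_ifs <;> omega
    by_cases hkm : k = c + b - 1
    · rw [h.left.count_eq hk0, hkm]
      split_ifs <;> omega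
    · have hY : count k Y = 0 := count_eq_zero.2 fun hy => by have := h.mem_mid k hy; omega
      rw [h.left.count_eq hk0, h.right.count_eq hkm, hY]
      split_ifs <;> omega

lemma not_sublist_of_pairwise {X B : List ℕ} (hX : ∀ x ∈ X, x < c) (hB : B.Pairwise (· ≤ ·)) :
    ∀ k, c ≤ k → ¬ [k + 1, k] <+ X ++ B := by
  intro k hk hs
  have h1 := pair_sublist_right hs fun hx => by have := hX _ hx; omega
  have := pairwise_iff_forall_sublist.1 hB h1
  omega

/-- The displayed `m` has exactly `b` letters `m` after it and the displayed `0` exactly `c` zeros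
before it. The part before this `m` splits as `X B`, and dually the part after this `0` as `A Z`. -/
lemma Good.exists_shape_of_split (h : Good c b W) (hd : Proper (c + b - 1) W) (hc : 1 ≤ c)
    (hb : 1 ≤ b) {U M V : List ℕ} (hW : W = U ++ (c + b - 1) :: (M ++ 0 :: V))
    (hU : count 0 (U ++ (c + b - 1) :: M) = c) (hV : count (c + b - 1) (M ++ 0 :: V) = b) :
    ∃ X B Y A Z, Shape c b X Y Z ∧
      W = X ++ ((B ++ [c + b - 1, c + b - 1]) ++ (Y ++ (([0, 0] ++ A) ++ Z))) ∧
      (B ++ [c + b - 1, c + b - 1]).Pairwise (· ≤ ·) ∧ ([0, 0] ++ A).Pairwise (· ≤ ·) ∧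
      (∀ x ∈ B, c ≤ x) ∧ ∀ x ∈ A, x < c := by
  obtain ⟨m, hm⟩ : ∃ m, m = c + b - 1 := ⟨_, rfl⟩
  have hm' : b + c - 1 = m := by omega
  have hrc := h.rc hd.1
  have hdrc := hd.rc
  have hWm := hd.1
  rw [← hm] at hW hU hV hrc hdrc hWm ⊢
  obtain ⟨X, B, rfl, hX, hB, hBs⟩ := h.exists_sorted_suffix hd hb (hm ▸ hW) (hm ▸ hV)
  have hVm : ∀ x ∈ V, x ≤ m := fun x hx => hWm x (by simp [hW, hx])
  have hUm : ∀ x ∈ (X ++ B) ++ m :: M, x ≤ m := fun x hx => hWm x (by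
    rw [hW, ← cons_append, ← append_assoc]; exact mem_append_left _ hx)
  obtain ⟨Z', A', hZA, hZ', hA', hA's⟩ := hrc.exists_sorted_suffix (hm'.symm ▸ hdrc) hc
    (F := PermPattern.rc m V) (V := PermPattern.rc m ((X ++ B) ++ m :: M))
    (by rw [hW, hm']; simp) (by rw [hm', count_rc hUm le_rfl, Nat.sub_self, hU])
  obtain ⟨A, hAe⟩ : ∃ A, A = PermPattern.rc m A' := ⟨_, rfl⟩
  obtain ⟨Z, hZe⟩ : ∃ Z, Z = PermPattern.rc m Z' := ⟨_, rfl⟩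
  obtain rfl : V = A ++ Z := by rw [← rc_rc hVm, hZA, rc_append, hAe, hZe]
  have hA : ∀ x ∈ A, x < c := by
    intro x hx
    simp only [hAe, PermPattern.rc, mem_reverse, mem_map] at hx
    obtain ⟨y, hy, rfl⟩ := hx
    have := hA' y hy
    omega
  have hZ : ∀ x ∈ Z, c ≤ x := by
    intro x hx
    simp only [hZe, PermPattern.rc, mem_reverse, mem_map] at hx
    obtain ⟨y, hy, rfl⟩ := hx
    have := hZ' y hy
    omega
  have hAs : A.Pairwise (· ≤ ·) := hAe ▸ pairwise_rc hA's
  -- A letter strictly between would give the decreasing triple `m`, `y`, `0`.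
  have hM : ∀ y ∈ M, y = 0 ∨ y = m := by
    intro y hy
    by_contra! hne
    have hym : y ≤ m := hUm y (by simp [hy])
    refine h.1 m y 0 ?_ (by omega) (by omega)
    have h1 : [y] <+ M := singleton_sublist.2 hy
    have h2 : [0] <+ 0 :: (A ++ Z) := by simp
    rw [hW]
    exact ((h1.append h2).cons_cons m).trans (sublist_append_right _ _)
  -- If a `0` came right after the displayed `m`, it would still have `b` letters `m` after it,
  -- forcing `m ≤ 0`. Dually, `M` ends in `0`. So each sorted block absorbs one more letter.
  obtain ⟨M, rfl⟩ : ∃ M', M = m :: M' := by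
    by_contra! hne
    obtain ⟨T, hT⟩ : ∃ T, M ++ 0 :: (A ++ Z) = 0 :: T := by
      cases M with
      | nil => exact ⟨_, rfl⟩
      | cons y M =>
        rcases hM y (by simp) with rfl | rfl
        · exact ⟨_, rfl⟩
        · exact absurd rfl (hne M)
    rw [hT] at hW hV
    have := h.le_of_replicate_after hd hb (y := 0) (hm ▸ hW) (by omega) (by
      rw [← hm]
      refine (replicate_sublist_iff.2 ?_).cons_cons 0
      rw [count_cons_of_ne (by omega)] at hV
      omega)
    omega
  have hlast : ∀ M', M ≠ M' ++ [m] := by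
    rintro M' rfl
    have := h.le_of_replicate_before hd hc (P := (X ++ B) ++ m :: (m :: (M' ++ [m])))
      (Q := A ++ Z) (x := m) (y := 0) (by rw [hW]; simp) (by omega) (by
        rw [← cons_append, ← cons_append, ← append_assoc]
        refine Sublist.append (replicate_sublist_iff.2 ?_) (Sublist.refl _)
        have hm0 : m ≠ 0 := by omega
        simp [count_append, hm0] at hU ⊢
        omega)
    omega
  obtain ⟨Y, rfl⟩ : ∃ Y, M = Y ++ [0] := by
    rcases eq_nil_or_concat M with rfl | ⟨Y, e, rfl⟩
    · have := h.le_of_replicate_before hd hc (P := (X ++ B) ++ [m] ++ [m])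
        (Q := A ++ Z) (x := m) (y := 0) (by rw [hW]; simp) (by omega) (by
          refine Sublist.append (replicate_sublist_iff.2 ?_) (Sublist.refl _)
          have hm0 : m ≠ 0 := by omega
          simp [count_append, hm0] at hU ⊢
          omega)
      omega
    · rw [concat_eq_append] at hlast hM
      rcases hM e (by simp) with rfl | rfl
      · exact ⟨Y, by simp⟩
      · exact absurd rfl (hlast Y)
  have hB0 : count 0 B = 0 := count_eq_zero.2 fun hx => by have := hB 0 hx; omega
  have hAm : count m A = 0 := count_eq_zero.2 fun hx => by have := hA m hx; omega
  have hm0 : m ≠ 0 := by omega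
  have hY : ∀ y ∈ Y, y = 0 ∨ y = m := fun y hy => hM y (by simp [hy])
  have hcU : count 0 X + count 0 Y + 1 = c := by
    simp [count_append, hm0, hB0] at hU
    omega
  have hcV : count m Y + count m Z + 1 = b := by
    simp [count_append, hm0.symm, hAm] at hV
    omega
  have hR : RightShape c b Z := by
    refine h.rightShape hd (F := X ++ B) (S := m :: (Y ++ [0, 0] ++ A)) (by rw [hW, ← hm]; simp)
      (not_sublist_of_pairwise hX hBs) ?_ hZ (by rw [← hm]; omega)
    intro k hk hck
    simp only [mem_cons, mem_append, not_mem_nil, or_false] at hk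
    rcases hk with rfl | (hk | rfl | rfl) | hk
    · omega
    · have := hY k hk; omega
    · omega
    · omega
    · have := hA k hk; omega
  have hXm : ∀ x ∈ X, x ≤ m := fun x hx => by have := hX x hx; omega
  have hL : LeftShape c X := by
    refine RightShape.leftShape (b := b) (hm ▸ hXm) hc ?_
    rw [← hm]
    refine hrc.rightShape (hm'.symm ▸ hdrc) (F := Z' ++ A')
      (S := m :: (PermPattern.rc m Y ++ [0, 0] ++ PermPattern.rc m B)) ?_
      (not_sublist_of_pairwise hZ' hA's) ?_ ?_ ?_
    · rw [hW, hm', ← hZA]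
      simp
    · intro k hk hbk
      simp only [mem_cons, mem_append, not_mem_nil, or_false] at hk
      rcases hk with rfl | (hk | rfl | rfl) | hk
      · omega
      · have hkm := le_of_mem_rc hk
        rw [mem_rc (fun y hy => by have := hY y hy; omega) hkm] at hk
        have := hY _ hk
        omega
      · omega
      · omega
      · have hkm := le_of_mem_rc hk
        rw [mem_rc (fun y hy => hUm y (by simp [hy])) hkm] at hk
        have := hB _ hk
        omega
    · intro z hz
      have hkm := le_of_mem_rc hz
      rw [mem_rc hXm hkm] at hz
      have := hX _ hz
      omega
    · rw [hm', count_rc hXm le_rfl, Nat.sub_self]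
      omega
  refine ⟨X, B, Y, A, Z, ⟨hL, hR, fun y hy => hm ▸ hY y hy, by omega, by rw [← hm]; omega⟩,
    by rw [hW]; simp, ?_, ?_, hB, hA⟩
  · rw [pairwise_append]
    refine ⟨hBs, by simp, fun x hx y hy => ?_⟩
    have := hUm x (by simp [hx])
    simp at hy
    omega
  · rw [pairwise_append]
    refine ⟨by simp, hAs, fun x hx y hy => ?_⟩
    simp at hx
    omega

/-- Suppose the chosen `0` came before the chosen `m`. A `c` before that `0` would force `c ≤ 0`, so
the pair `c`, `c - 1` given by properness lies after it; then the `c` zeros before it force `c ≤ c -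
1`. -/
lemma Good.exists_split (h : Good c b W) (hd : Proper (c + b - 1) W) (hc : 1 ≤ c)
    (hb : 1 ≤ b) (h0 : c < count 0 W) (hm : b < count (c + b - 1) W) :
    ∃ U M V, W = U ++ (c + b - 1) :: (M ++ 0 :: V) ∧ count 0 (U ++ (c + b - 1) :: M) = c ∧
      count (c + b - 1) (M ++ 0 :: V) = b := by
  obtain ⟨U, V, hUV, hU⟩ := exists_split_of_lt_count
    (show count (c + b - 1) W - b - 1 < count (c + b - 1) W by omega)
  obtain ⟨U', V', hUV', hU'⟩ := exists_split_of_lt_count h0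
  have hV : count (c + b - 1) V = b := by
    rw [hUV, count_append, count_cons_self] at hU hm
    omega
  rcases append_eq_append_cons (hUV.symm.trans hUV') with ⟨L, rfl, rfl⟩ | ⟨R, rfl, hR⟩
  · exfalso
    have h1 := hd.2 (c - 1) (by omega)
    rw [Nat.sub_add_cancel hc, hUV'] at h1
    have hcU : c ∉ U' := by
      intro hmem
      obtain ⟨A, B, rfl⟩ := append_of_mem hmem
      have := h.le_of_replicate_after hd hb (P := A) (Q := B ++ 0 :: (L ++ (c + b - 1) :: V))
        (y := 0) (by rw [hUV']; simp) le_rfl (by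
          refine Sublist.trans (Sublist.cons_cons _ ?_) (sublist_append_right _ _)
          refine Sublist.trans ?_ (sublist_append_right _ _)
          exact (replicate_sublist_iff.2 hV.ge).trans (sublist_cons_self _ _))
      omega
    have h2 := pair_sublist_right h1 hcU
    rw [cons_sublist_cons'] at h2
    have h3 := h2.resolve_right (by omega)
    obtain ⟨P, Q, e, hP, -⟩ := exists_split_of_sublist (xs := [c]) (v := c - 1) (ys := []) h3
    have := h.le_of_replicate_before hd hc (P := U' ++ 0 :: P) (Q := Q) (x := c) (y := c - 1)
      (by rw [hUV', e]; simp) (by omega) ((replicate_sublist_iff.2 hU'.ge).append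
        (hP.trans (sublist_cons_self _ _)))
    omega
  · cases R with
    | nil => simp at hR; omega
    | cons a M =>
      simp only [cons_append, cons.injEq] at hR
      obtain ⟨rfl, rfl⟩ := hR
      exact ⟨U, M, V', hUV, hU', hV⟩

lemma exists_shape_of_mem_goodWords (hc : 1 ≤ c) (hb : 1 ≤ b) (hκ : c + b + 1 ≤ κ)
    (h : W ∈ goodWords c b (c + b - 1) fun _ => κ) :
    ∃ X Y Z, Shape c b X Y Z ∧ W = wordOfShape c b κ X Y Z := by
  obtain ⟨hg, hd, hk⟩ := h
  have hcount : ∀ k ≤ c + b - 1, count k W = κ := fun k hk' => hk ⟨k, by omega⟩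
  obtain ⟨U, M, V, h1, h2, h3⟩ := hg.exists_split hd hc hb (by rw [hcount 0 (by omega)]; omega)
    (by rw [hcount _ le_rfl]; omega)
  obtain ⟨X, B, Y, A, Z, hs, hW, hBs, hAs, hB, hA⟩ := hg.exists_shape_of_split hd hc hb h1 h2 h3
  refine ⟨X, Y, Z, hs, ?_⟩
  have hX := hs.mem_left hc
  have hZ := hs.mem_right hb
  have hBm : ∀ x ∈ B, x ≤ c + b - 1 := fun x hx => hd.1 x (by simp [hW, hx])
  have hcm : ∀ k, k < c → count k (B ++ [c + b - 1, c + b - 1]) = 0 := fun k hk' =>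
    count_eq_zero.2 fun hx => by
      simp only [mem_append, mem_cons, not_mem_nil, or_false] at hx
      rcases hx with hx | hx | hx
      · have := hB k hx; omega
      · omega
      · omega
  have hc0 : ∀ k, c ≤ k → count k ([0, 0] ++ A) = 0 := fun k hk' =>
    count_eq_zero.2 fun hx => by
      simp only [mem_append, mem_cons, not_mem_nil, or_false] at hx
      rcases hx with (hx | hx) | hx
      · omega
      · omega
      · have := hA k hx; omega
  have key : ∀ k ≤ c + b - 1, count k X + (count k (B ++ [c + b - 1, c + b - 1]) + (count k Y +
      (count k ([0, 0] ++ A) + count k Z))) = κ := fun k hk' => by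
    rw [← hcount k hk', hW]
    simp only [count_append]
  have hY : ∀ k, k ≠ 0 → k ≠ c + b - 1 → count k Y = 0 := fun k h0 hm =>
    count_eq_zero.2 fun hy => by have := hs.mem_mid k hy; omega
  have e0 := hs.count_zero
  have e1 := hs.count_top
  -- A sorted word is determined by its letter counts, here what is left of `κ` after the other
  -- parts.
  have eB : B ++ [c + b - 1, c + b - 1] = upperBlock c b κ := by
    refine eq_of_count_eq hBs (pairwise_upperBlock _ _ _) fun k => ?_
    rw [count_upperBlock]
    rcases lt_or_ge k c with hkc | hkc
    · rw [hcm k hkc]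
      split_ifs <;> omega
    rcases lt_trichotomy k (c + b - 1) with hkm | hkm | hkm
    · have := key k hkm.le
      rw [hs.left.count_eq (by omega), hs.right.count_eq (by omega), hY k (by omega) (by omega),
        hc0 k hkc] at this
      split_ifs at this ⊢ <;> omega
    · subst hkm
      have := key _ le_rfl
      rw [hs.left.count_eq (by omega), hc0 _ hkc] at this
      split_ifs at this ⊢ <;> omega
    · rw [count_eq_zero.2 fun hx => by
        simp only [mem_append, mem_cons, not_mem_nil, or_false] at hx
        rcases hx with hx | hx | hx
        · have := hBm k hx; omega
        · omega
        · omega]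
      split_ifs <;> omega
  have eA : [0, 0] ++ A = lowerBlock c κ := by
    refine eq_of_count_eq hAs (pairwise_lowerBlock _ _) fun k => ?_
    rw [count_lowerBlock]
    rcases lt_or_ge k c with hkc | hkc
    · have := key k (by omega)
      rw [hs.right.count_eq (by omega), hcm k hkc] at this
      by_cases hk0 : k = 0
      · subst hk0
        split_ifs at this ⊢ <;> omega
      · rw [hs.left.count_eq hk0, hY k hk0 (by omega)] at this
        split_ifs at this ⊢ <;> omega
    · rw [hc0 k hkc]
      split_ifs <;> omega
  rw [hW, eB, eA, wordOfShape]

lemma append_cons_inj_of_forall {α : Type*} {p : α → Prop} {A A' R R' : List α} {u u' : α}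
    (h : A ++ u :: R = A' ++ u' :: R') (hA : ∀ x ∈ A, p x) (hA' : ∀ x ∈ A', p x) (hu : ¬ p u)
    (hu' : ¬ p u') : A = A' ∧ u :: R = u' :: R' := by
  induction A generalizing A' with
  | nil =>
    cases A' with
    | nil => exact ⟨rfl, h⟩
    | cons a A' =>
      simp only [nil_append, cons_append, cons.injEq] at h
      exact absurd (hA' u (by simp [h.1])) hu
  | cons a A ih =>
    cases A' with
    | nil =>
      simp only [nil_append, cons_append, cons.injEq] at h
      exact absurd (hA u' (by simp [h.1])) hu'
    | cons a' A' =>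
      simp only [cons_append, cons.injEq] at h
      obtain ⟨rfl, h⟩ := h
      obtain ⟨h1, h2⟩ := ih h (fun x hx => hA x (by simp [hx])) fun x hx => hA' x (by simp [hx])
      exact ⟨by rw [h1], h2⟩

lemma append_inj_of_forall {α : Type*} {p : α → Prop} {A A' B B' : List α}
    (h : A ++ B = A' ++ B') (hA : ∀ x ∈ A, p x) (hA' : ∀ x ∈ A', p x)
    (hB : ∃ u R, B = u :: R ∧ ¬ p u) (hB' : ∃ u R, B' = u :: R ∧ ¬ p u) : A = A' ∧ B = B' := by
  obtain ⟨u, R, rfl, hu⟩ := hB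
  obtain ⟨u', R', rfl, hu'⟩ := hB'
  exact append_cons_inj_of_forall h hA hA' hu hu'

/-- `X` ends at the first letter `≥ c`. Read from the right, `Z` ends at the first letter `< c`. -/
lemma wordOfShape_inj {X' Y' Z' : List ℕ} (hc : 1 ≤ c) (hb : 1 ≤ b) (hκ : c + b + 1 ≤ κ)
    (h : Shape c b X Y Z) (h' : Shape c b X' Y' Z')
    (e : wordOfShape c b κ X Y Z = wordOfShape c b κ X' Y' Z') : X = X' ∧ Y = Y' ∧ Z = Z' := by
  have hB : ∀ T, ∃ u R, upperBlock c b κ ++ T = u :: R ∧ ¬ u < c := by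
    intro T
    cases e : upperBlock c b κ with
    | nil =>
      have := (mem_upperBlock (c := c) (κ := κ) (x := c) hb (by omega)).2 (by omega)
      simp [e] at this
    | cons u R =>
      exact ⟨u, R ++ T, rfl, by
        have := (mem_upperBlock (c := c) (κ := κ) (x := u) hb (by omega)).1 (by simp [e]); omega⟩
  have hA : ∀ T, ∃ u R, (lowerBlock c κ).reverse ++ T = u :: R ∧ ¬ c ≤ u := by
    intro T
    cases e : (lowerBlock c κ).reverse with
    | nil =>
      have := (mem_lowerBlock (c := c) (κ := κ) (x := 0) hc (by omega)).2 (by omega)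
      rw [reverse_eq_nil_iff] at e
      simp [e] at this
    | cons u R =>
      refine ⟨u, R ++ T, rfl, ?_⟩
      have := (mem_lowerBlock (c := c) (κ := κ) (x := u) hc (by omega)).1
        (by rw [← mem_reverse]; simp [e])
      omega
  obtain ⟨rfl, e1⟩ := append_inj_of_forall (p := (· < c)) e (h.mem_left hc) (h'.mem_left hc) (hB _)
    (hB _)
  have e2 := congrArg reverse (append_cancel_left e1)
  simp only [reverse_append, append_assoc] at e2
  obtain ⟨e3, e4⟩ := append_inj_of_forall (p := (c ≤ ·)) e2
    (fun x hx => (h.mem_right hb x (by simpa using hx)).1)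
    (fun x hx => (h'.mem_right hb x (by simpa using hx)).1) (hA _) (hA _)
  exact ⟨rfl, reverse_injective (append_cancel_left e4), reverse_injective e3⟩

/-! ### Shapes and Dyck words -/

/-- The lists of steps of the Dyck words of semilength `m`. -/
def dyckLists (m : ℕ) : Set (List DyckStep) :=
  {w | count .U w = m ∧ count .D w = m ∧ ∀ P R, w = P ++ R → count .D P ≤ count .U P}

lemma ncard_dyckLists (m : ℕ) : (dyckLists m).ncard = catalan m := by
  rw [← DyckWord.card_dyckWord_semilength_eq_catalan, ← Nat.card_eq_fintype_card,
    ← Nat.card_coe_set_eq]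
  refine Nat.card_congr ⟨fun w => ⟨⟨w.1, w.2.1.trans w.2.2.1.symm, fun i =>
      w.2.2.2 _ _ (take_append_drop i w.1).symm⟩, w.2.1⟩,
    fun p => ⟨p.1.toList, p.2, p.1.count_U_eq_count_D.symm.trans p.2, fun P R h => ?_⟩,
    fun _ => rfl, fun _ => rfl⟩
  have := p.1.count_D_le_count_U P.length
  rwa [h, take_left'] at this
  rfl

/-- The list of steps with a step `α` for each letter `t` and a step `β` for each other letter. -/
def mark (t : ℕ) (α β : DyckStep) (X : List ℕ) : List DyckStep :=
  X.map fun x => if x = t then α else β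

section mark

variable {t : ℕ} {α β : DyckStep}

lemma mark_append (A B : List ℕ) : mark t α β (A ++ B) = mark t α β A ++ mark t α β B := by
  simp [mark]

lemma mark_eq_append {P R : List DyckStep} (h : mark t α β X = P ++ R) :
    ∃ A B, X = A ++ B ∧ mark t α β A = P ∧ mark t α β B = R :=
  map_eq_append_iff.1 h

lemma count_mark_left (h : α ≠ β) (X : List ℕ) : count α (mark t α β X) = count t X := by
  induction X with
  | nil => rfl
  | cons a X ih =>
    rw [mark, map_cons, count_cons, count_cons]
    rw [mark] at ih
    rw [ih]
    by_cases ha : a = t <;> simp [ha, h.symm]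

lemma count_mark_right (h : α ≠ β) (X : List ℕ) :
    count β (mark t α β X) = (X.filter (· ≠ t)).length := by
  induction X with
  | nil => rfl
  | cons a X ih =>
    rw [mark, map_cons, count_cons]
    rw [mark] at ih
    rw [ih]
    by_cases ha : a = t <;> simp [ha, h]

lemma count_mark_right_of_mem (h : α ≠ β) {s : ℕ} (hst : s ≠ t) (hY : ∀ y ∈ Y, y = s ∨ y = t) :
    count β (mark t α β Y) = count s Y := by
  induction Y with
  | nil => rfl
  | cons a Y ih =>
    have ih := ih fun y hy => hY y (by simp [hy])
    rw [mark] at ih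
    rw [mark, map_cons, count_cons, count_cons, ih]
    rcases hY a (by simp) with rfl | rfl
    · simp [hst]
    · simp [hst.symm, h]

lemma mark_inj (h : α ≠ β) {X' : List ℕ} (e : mark t α β X = mark t α β X')
    (hf : X.filter (· ≠ t) = X'.filter (· ≠ t)) : X = X' := by
  induction X generalizing X' with
  | nil =>
    cases X' with
    | nil => rfl
    | cons a X' => simp [mark] at e
  | cons a X ih =>
    cases X' with
    | nil => simp [mark] at e
    | cons a' X' =>
      simp only [mark, map_cons, cons.injEq] at e
      obtain ⟨e1, e2⟩ := e
      by_cases ha : a = t <;> by_cases ha' : a' = t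
      · simp only [ha, ha', ne_eq, not_true_eq_false, decide_false, Bool.false_eq_true,
          not_false_eq_true, filter_cons_of_neg] at hf
        rw [ha, ha', ih e2 hf]
      · simp [ha, ha', h] at e1
      · simp [ha, ha', h.symm] at e1
      · rw [filter_cons_of_pos (by simpa using ha), filter_cons_of_pos (by simpa using ha'),
          cons.injEq] at hf
        rw [hf.1, ih e2 hf.2]

lemma mark_inj_of_mem (h : α ≠ β) {s : ℕ} {Y' : List ℕ} (hY : ∀ y ∈ Y, y = s ∨ y = t)
    (hY' : ∀ y ∈ Y', y = s ∨ y = t) (e : mark t α β Y = mark t α β Y') : Y = Y' := by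
  have key : ∀ {Y : List ℕ}, (∀ y ∈ Y, y = s ∨ y = t) →
      (mark t α β Y).map (fun x => if x = α then t else s) = Y := by
    intro Y hY
    rw [mark, map_map]
    conv_rhs => rw [← map_id Y]
    refine map_congr_left fun y hy => ?_
    by_cases hyt : y = t
    · simp [hyt]
    · have := (hY y hy).resolve_right hyt
      subst this
      simp [hyt, h.symm]
  rw [← key hY, e, key hY']

/-- The steps `β` receive the labels `s, s + 1, …` in order, none of which is `t`. -/
lemma exists_mark_eq (h : ∀ x, x = α ∨ x = β) (hαβ : α ≠ β) (P : List DyckStep) {s : ℕ}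
    (ht : ∀ i < count β P, s + i ≠ t) :
    ∃ X, mark t α β X = P ∧ X.filter (· ≠ t) = range' s (count β P) := by
  induction P generalizing s with
  | nil => exact ⟨[], rfl, rfl⟩
  | cons a P ih =>
    rcases h a with rfl | rfl
    · rw [count_cons_of_ne hαβ] at ht ⊢
      obtain ⟨X, h1, h2⟩ := ih ht
      exact ⟨t :: X, by rw [← h1]; simp [mark], by simpa using h2⟩
    · rw [count_cons_self] at ht ⊢
      have hs : s ≠ t := ht 0 (by omega)
      obtain ⟨X, h1, h2⟩ := ih (s := s + 1) fun i hi => by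
        have := ht (i + 1) (by omega)
        omega
      refine ⟨s :: X, by rw [← h1]; simp [mark, hs], ?_⟩
      rw [filter_cons_of_pos (by simpa using hs), h2, range'_succ]

lemma exists_mark_eq_of_mem (h : ∀ x, x = α ∨ x = β) (P : List DyckStep) {s : ℕ} (hst : s ≠ t) :
    ∃ Y, mark t α β Y = P ∧ ∀ y ∈ Y, y = s ∨ y = t := by
  induction P with
  | nil => exact ⟨[], rfl, by simp⟩
  | cons a P ih =>
    obtain ⟨Y, h1, h2⟩ := ih
    rcases h a with rfl | rfl
    · exact ⟨t :: Y, by rw [← h1]; simp [mark], by simpa using h2⟩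
    · exact ⟨s :: Y, by rw [← h1]; simp [mark, hst], by simpa using h2⟩

end mark

lemma step_eq_U_or_D (x : DyckStep) : x = .U ∨ x = .D := by cases x <;> simp

lemma step_eq_D_or_U (x : DyckStep) : x = .D ∨ x = .U := by cases x <;> simp

/-- The step list of the Dyck word that encodes the free parts of a good word. -/
def dyckOfShape (c b : ℕ) (X Y Z : List ℕ) : List DyckStep :=
  mark 0 .D .U X ++ .U :: (mark (c + b - 1) .U .D Y ++ .D :: mark (c + b - 1) .U .D Z)

lemma Shape.count_mark (h : Shape c b X Y Z) (hcb : 2 ≤ c + b) :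
    count .U (mark 0 .D .U X) = c - 1 ∧ count .D (mark 0 .D .U X) = count 0 X ∧
    count .U (mark (c + b - 1) .U .D Y) = count (c + b - 1) Y ∧
    count .D (mark (c + b - 1) .U .D Y) = count 0 Y ∧
    count .U (mark (c + b - 1) .U .D Z) = count (c + b - 1) Z ∧
    count .D (mark (c + b - 1) .U .D Z) = b - 1 := by
  refine ⟨?_, count_mark_left (by simp) _, count_mark_left (by simp) _,
    count_mark_right_of_mem (by simp) (by omega) h.mem_mid, count_mark_left (by simp) _, ?_⟩
  · rw [count_mark_right (by simp), h.left.filter_eq, length_range']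
  · rw [count_mark_right (by simp), h.right.filter_eq, length_range']

lemma Shape.mem_dyckLists (h : Shape c b X Y Z) (hc : 1 ≤ c) (hb : 1 ≤ b) :
    dyckOfShape c b X Y Z ∈ dyckLists (c + b - 1) := by
  obtain ⟨h1, h2, h3, h4, h5, h6⟩ := h.count_mark (by omega)
  have h7 := h.count_zero
  have h8 := h.count_top
  have eU : count .U (dyckOfShape c b X Y Z) = c + b - 1 := by
    simp only [dyckOfShape, count_append, count_cons, h1, h3, h5]
    simp
    omega
  have eD : count .D (dyckOfShape c b X Y Z) = c + b - 1 := by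
    simp only [dyckOfShape, count_append, count_cons, h2, h4, h6]
    simp
    omega
  refine ⟨eU, eD, fun P R e => ?_⟩
  have eU' := eU
  have eD' := eD
  rw [e, count_append] at eU' eD'
  rw [dyckOfShape] at e
  -- Prefixes inside the first piece are handled by `LeftShape`. Those ending in the middle have at
  -- least `c` up steps and at most `c - 1` down steps. Those reaching past the separating down step
  -- follow from the suffix inequality of `RightShape`, as the totals agree.
  rcases append_eq_append_iff.1 e with ⟨P1, rfl, e1⟩ | ⟨S, e1, -⟩
  · cases P1 with
    | nil =>
      have := h.left.count_le X [] (by simp)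
      rw [h.left.filter_eq, length_range'] at this
      rw [append_nil]
      omega
    | cons a P1 =>
      simp only [cons_append, cons.injEq] at e1
      obtain ⟨rfl, e1⟩ := e1
      rcases append_eq_append_iff.1 e1 with ⟨P2, rfl, e2⟩ | ⟨S, e2, -⟩
      · cases P2 with
        | nil =>
          simp [count_append, h1, h2, h4]
          omega
        | cons a P2 =>
          simp only [cons_append, cons.injEq] at e2
          obtain ⟨rfl, e2⟩ := e2
          obtain ⟨Z1, Z2, e3, -, rfl⟩ := mark_eq_append e2
          have := h.right.count_le Z1 Z2 e3
          rw [count_mark_left (by simp)] at eU'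
          rw [count_mark_right (by simp)] at eD'
          omega
      · have : count .D P1 ≤ count 0 Y := by
          rw [← h4, e2]
          exact (sublist_append_left _ _).count_le _
        simp [count_append, h1, h2]
        omega
  · obtain ⟨X1, X2, e3, rfl, -⟩ := mark_eq_append e1
    have := h.left.count_le X1 X2 e3
    rwa [count_mark_left (by simp), count_mark_right (by simp)]

lemma dyckOfShape_inj {X' Y' Z' : List ℕ} (hcb : 2 ≤ c + b) (h : Shape c b X Y Z)
    (h' : Shape c b X' Y' Z') (e : dyckOfShape c b X Y Z = dyckOfShape c b X' Y' Z') :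
    X = X' ∧ Y = Y' ∧ Z = Z' := by
  obtain ⟨h1, h2, h3, h4, h5, h6⟩ := h.count_mark (by omega)
  obtain ⟨h1', h2', h3', h4', h5', h6'⟩ := h'.count_mark (by omega)
  obtain ⟨e1, e2⟩ := append_cons_inj_of_count_eq e (h1.trans h1'.symm)
  have e3 := h.count_zero
  have e3' := h'.count_zero
  have e4 : count 0 X = count 0 X' := by rw [← h2, ← h2', e1]
  obtain ⟨e5, e6⟩ := append_cons_inj_of_count_eq e2 (by omega)
  exact ⟨mark_inj (by simp) e1 (h.left.filter_eq.trans h'.left.filter_eq.symm),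
    mark_inj_of_mem (by simp) h.mem_mid h'.mem_mid e5,
    mark_inj (by simp) e6 (h.right.filter_eq.trans h'.right.filter_eq.symm)⟩

lemma exists_shape_of_mem_dyckLists (hc : 1 ≤ c) (hb : 1 ≤ b) {w : List DyckStep}
    (hw : w ∈ dyckLists (c + b - 1)) :
    ∃ X Y Z, Shape c b X Y Z ∧ dyckOfShape c b X Y Z = w := by
  obtain ⟨hU, hD, hp⟩ := hw
  obtain ⟨P, R, e1, h1⟩ := exists_split_of_lt_count (show c - 1 < count .U w by omega)
  obtain ⟨P', S, e2, h2⟩ := exists_split_of_lt_count (show c - 1 < count .D w by omega)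
  -- The `c`-th up step precedes the `c`-th down step; otherwise the prefix ending at that down step
  -- has more down steps than up steps.
  rcases append_eq_append_cons (e1.symm.trans e2) with ⟨L, rfl, -⟩ | ⟨Q, rfl, e3⟩
  · have := hp (P' ++ [.D]) S (by simp [e2])
    simp [count_append] at this h1
    omega
  cases Q with
  | nil => simp at e3
  | cons a Q =>
  simp only [cons_append, cons.injEq] at e3
  obtain ⟨rfl, rfl⟩ := e3
  have hU' := hU
  have hD' := hD
  rw [e1] at hU' hD'
  simp only [count_append, count_cons] at hU' hD' h2
  simp at hU' hD' h2
  obtain ⟨X, rfl, hX⟩ := exists_mark_eq (t := 0) (s := 1) step_eq_D_or_U (by simp) P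
    (fun i hi => by omega)
  obtain ⟨Z, rfl, hZ⟩ := exists_mark_eq (t := c + b - 1) (s := c) step_eq_U_or_D (by simp) S
    (fun i hi => by omega)
  obtain ⟨Y, rfl, hY⟩ := exists_mark_eq_of_mem (t := c + b - 1) (s := 0) step_eq_U_or_D Q (by omega)
  rw [count_mark_left (by simp)] at hD' h2
  rw [count_mark_left (by simp), count_mark_left (by simp)] at hU'
  rw [count_mark_right_of_mem (by simp) (by omega) hY] at hD' h2
  refine ⟨X, Y, Z, ⟨⟨?_, ?_⟩, ⟨?_, ?_⟩, hY, by omega, by omega⟩, e1.symm⟩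
  · rw [hX]
    congr 1
  · rintro X1 X2 rfl
    have := hp (mark 0 .D .U X1) _ (by rw [e1, mark_append, append_assoc])
    rwa [count_mark_left (by simp), count_mark_right (by simp)] at this
  · rw [hZ]
    congr 1
    omega
  · rintro Z1 Z2 rfl
    have e4 : w = (mark 0 .D .U X ++ .U :: (mark (c + b - 1) .U .D Y ++ .D ::
        mark (c + b - 1) .U .D Z1)) ++ mark (c + b - 1) .U .D Z2 := by
      rw [e1, mark_append]
      simp
    have := hp _ _ e4
    rw [e4, count_append] at hU hD
    rw [← count_mark_left (α := .U) (β := .D) (by simp), ← count_mark_right (α := .U) (β := .D) (by simp)]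
    omega

lemma ncard_goodWords_of_pos (hc : 1 ≤ c) (hb : 1 ≤ b) (hκ : c + b + 1 ≤ κ) :
    (goodWords c b (c + b - 1) fun _ => κ).ncard = catalan (c + b - 1) := by
  have e1 : {t : List ℕ × List ℕ × List ℕ | Shape c b t.1 t.2.1 t.2.2}.ncard =
      (goodWords c b (c + b - 1) fun _ => κ).ncard := by
    refine Set.ncard_congr (fun t _ => wordOfShape c b κ t.1 t.2.1 t.2.2)
      (fun t ht => Shape.mem_goodWords ht hc hb hκ) ?_ ?_
    · rintro ⟨X, Y, Z⟩ ⟨X', Y', Z'⟩ h h' e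
      obtain ⟨rfl, rfl, rfl⟩ := wordOfShape_inj hc hb hκ h h' e
      rfl
    · intro W hW
      obtain ⟨X, Y, Z, h, rfl⟩ := exists_shape_of_mem_goodWords hc hb hκ hW
      exact ⟨(X, Y, Z), h, rfl⟩
  rw [← e1, ← ncard_dyckLists]
  refine Set.ncard_congr (fun t _ => dyckOfShape c b t.1 t.2.1 t.2.2)
    (fun t ht => Shape.mem_dyckLists ht hc hb) ?_ ?_
  · rintro ⟨X, Y, Z⟩ ⟨X', Y', Z'⟩ h h' e
    obtain ⟨rfl, rfl, rfl⟩ := dyckOfShape_inj (by omega) h h' e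
    rfl
  · intro w hw
    obtain ⟨X, Y, Z, h, rfl⟩ := exists_shape_of_mem_dyckLists hc hb hw
    exact ⟨(X, Y, Z), h, rfl⟩

/-! ### The case `c = 0` -/

lemma RightShape.mem_goodWords (h : RightShape 0 b Z) (hc : count (0 + b - 1) Z = b - 1)
    (hb : 2 ≤ b) (hκ : b + 1 ≤ κ) :
    upperBlock 0 b κ ++ Z ∈ goodWords 0 b (0 + b - 1) fun _ => κ := by
  have hB := fun x => mem_upperBlock (c := 0) (κ := κ) (x := x) (show 1 ≤ b by omega) hκ
  refine ⟨h.good (by omega) (pairwise_upperBlock _ _ _) (fun x hx => ((hB x).1 hx).2), ⟨?_, ?_⟩, ?_⟩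
  · intro x hx
    rcases mem_append.1 hx with hx | hx
    · exact ((hB x).1 hx).2
    · by_cases hxm : x = 0 + b - 1
      · omega
      · have := (h.mem_iff hxm).1 hx
        omega
  · intro i hi
    exact (singleton_sublist.2 ((hB (i + 1)).2 (by omega))).append
      (singleton_sublist.2 ((h.mem_iff (by omega)).2 (by omega)))
  · rintro ⟨k, hk⟩
    simp only [count_append, count_upperBlock]
    by_cases hkm : k = 0 + b - 1
    · rw [hkm, hc]
      split_ifs <;> omega
    · rw [h.count_eq hkm]
      split_ifs <;> omega

lemma exists_rightShape_of_mem_goodWords (hb : 2 ≤ b) (hκ : b + 1 ≤ κ)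
    (hW : W ∈ goodWords 0 b (0 + b - 1) fun _ => κ) :
    ∃ Z, (RightShape 0 b Z ∧ count (0 + b - 1) Z = b - 1) ∧ upperBlock 0 b κ ++ Z = W := by
  obtain ⟨h, hd, hk⟩ := hW
  obtain ⟨m, hm⟩ : ∃ m, m = 0 + b - 1 := ⟨_, rfl⟩
  have hcount : ∀ k ≤ m, count k W = κ := fun k hk' => hk ⟨k, by omega⟩
  obtain ⟨U, V, hUV, hU⟩ := exists_split_of_lt_count
    (show κ - b - 1 < count m W by rw [hcount m le_rfl]; omega)
  have hV : count m V = b := by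
    have := hcount m le_rfl
    rw [hUV, count_append, count_cons_self] at this
    omega
  obtain ⟨X, B, rfl, hX, -, hBs⟩ := h.exists_sorted_suffix hd (by omega) (hm ▸ hUV) (hm ▸ hV)
  obtain rfl : X = [] := eq_nil_iff_forall_not_mem.2 fun x hx => by have := hX x hx; omega
  rw [nil_append] at hUV
  obtain ⟨Z, rfl⟩ : ∃ Z, V = m :: Z := by
    cases V with
    | nil => simp at hV; omega
    | cons y V =>
      have hym : y ≤ m := hm ▸ hd.1 y (by simp [hUV])
      -- The letter `y` right after the cut is `m`: with `c = 0` the removed entry is the `m` at the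
      -- cut, and `y` followed by `b - 1` letters `m` is sorted.
      have := h.le_right (xs := []) (v := m) (ys := y :: replicate (b - 1) m) (by
        rw [hUV, nil_append]
        refine Sublist.trans ?_ (sublist_append_right _ _)
        refine ((replicate_sublist_iff.2 ?_).cons_cons y).cons_cons m
        rw [count_cons] at hV
        split_ifs at hV <;> omega) rfl (by simp; omega)
        (by simp [pairwise_replicate]; omega) y (by simp)
      exact ⟨V, by rw [le_antisymm hym this]⟩
  rw [count_cons_self] at hV
  have hR : RightShape 0 b Z := by
    refine h.rightShape hd (F := B) (S := [m]) (by rw [hUV, ← hm]; rfl) ?_ ?_ (by simp)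
      (by rw [← hm]; omega)
    · intro k hk hs
      have := pairwise_iff_forall_sublist.1 hBs hs
      omega
    · intro k hk _
      rw [mem_singleton] at hk
      omega
  have hBm : ∀ x ∈ B, x ≤ m := fun x hx => hm ▸ hd.1 x (by simp [hUV, hx])
  refine ⟨Z, ⟨hR, by rw [← hm]; omega⟩, ?_⟩
  have e : B ++ [m, m] = upperBlock 0 b κ := by
    refine eq_of_count_eq ?_ (pairwise_upperBlock _ _ _) fun k => ?_
    · rw [pairwise_append]
      refine ⟨hBs, by simp, fun x hx y hy => ?_⟩
      have := hBm x hx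
      simp at hy
      omega
    · have h1 : count k W = count k (B ++ [m, m]) + count k Z := by
        rw [hUV, ← count_append]
        simp
      rw [count_upperBlock]
      rcases lt_trichotomy k m with hkm | rfl | hkm
      · rw [hcount k hkm.le, hR.count_eq (by omega)] at h1
        split_ifs at h1 ⊢ <;> omega
      · rw [hcount k le_rfl] at h1
        split_ifs <;> omega
      · rw [count_eq_zero.2 fun hx => by have := hd.1 k hx; omega] at h1
        split_ifs <;> omega
  rw [← e, hUV]
  simp

/-- `Z` has `b - 1` top letters and `b - 1` others, and its suffix condition is the Dyck prefix
condition, since the totals agree. -/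
lemma ncard_goodWords_zero_left (hb : 2 ≤ b) (hκ : b + 1 ≤ κ) :
    (goodWords 0 b (0 + b - 1) fun _ => κ).ncard = catalan (0 + b - 1) := by
  have e1 : {Z : List ℕ | RightShape 0 b Z ∧ count (0 + b - 1) Z = b - 1}.ncard =
      (goodWords 0 b (0 + b - 1) fun _ => κ).ncard :=
    Set.ncard_congr (fun Z _ => upperBlock 0 b κ ++ Z) (fun Z h => h.1.mem_goodWords h.2 hb hκ)
      (fun Z Z' _ _ e => append_cancel_left e) fun W hW => by
        obtain ⟨Z, h, e⟩ := exists_rightShape_of_mem_goodWords hb hκ hW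
        exact ⟨Z, h, e⟩
  rw [← e1, ← ncard_dyckLists]
  refine Set.ncard_congr (fun Z _ => mark (0 + b - 1) .U .D Z) ?_ ?_ ?_
  · rintro Z ⟨h, hZ⟩
    have hD : count .D (mark (0 + b - 1) .U .D Z) = b - 1 := by
      rw [count_mark_right (by simp), h.filter_eq, length_range']
    have hU : count .U (mark (0 + b - 1) .U .D Z) = b - 1 := by
      rw [count_mark_left (by simp), hZ]
    refine ⟨by omega, by omega, fun P R e => ?_⟩
    rw [e, count_append] at hD hU
    obtain ⟨Z1, Z2, e1, -, rfl⟩ := mark_eq_append e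
    have := h.count_le Z1 Z2 e1
    rw [count_mark_left (by simp)] at hU
    rw [count_mark_right (by simp)] at hD
    omega
  · rintro Z Z' ⟨h, -⟩ ⟨h', -⟩ e
    exact mark_inj (by simp) e (h.filter_eq.trans h'.filter_eq.symm)
  · rintro w ⟨hU, hD, hp⟩
    obtain ⟨Z, rfl, hZ⟩ := exists_mark_eq (t := 0 + b - 1) (s := 0) step_eq_U_or_D (by simp) w
      (fun i hi => by omega)
    have hU' := hU
    rw [count_mark_left (by simp)] at hU'
    refine ⟨Z, ⟨⟨?_, ?_⟩, by omega⟩, rfl⟩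
    · rw [hZ, hD]
      congr 1
      omega
    · rintro Z1 Z2 rfl
      have := hp _ _ (mark_append Z1 Z2)
      rw [mark_append, count_append] at hU hD
      rw [← count_mark_left (α := .U) (β := .D) (by simp), ← count_mark_right (α := .U) (β := .D) (by simp)]
      omega

theorem ncard_goodWords_eq_catalan (hcb : 2 ≤ c + b) (hκ : c + b + 1 ≤ κ) :
    (goodWords c b (c + b - 1) (fun _ => κ)).ncard = catalan (c + b - 1) := by
  rcases Nat.eq_zero_or_pos c with rfl | hc
  · exact ncard_goodWords_zero_left (by omega) (by omega)
  rcases Nat.eq_zero_or_pos b with rfl | hb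
  · rw [ncard_goodWords_rc, add_comm c 0]
    exact ncard_goodWords_zero_left (by omega) (by omega)
  · exact ncard_goodWords_of_pos hc hb hκ

end PermPattern

/-! ### The counting polynomial and its leading term -/

namespace PermPattern

open Polynomial

/-- The class is counted by a polynomial whose leading term is given by a Catalan number. -/
theorem exists_poly_ncard_Av {c b : ℕ} (hcb : 2 ≤ c + b) :
    ∃ p : ℚ[X], EventuallyCounts p (partialShuffle (c + 1) b ∪ {decreasing 3}) ∧
      p.natDegree ≤ c + b - 1 ∧
      p.coeff (c + b - 1) = catalan (c + b - 1) * (((c + b - 1).factorial : ℚ))⁻¹ := by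
  obtain ⟨m, hm⟩ : ∃ m, c + b = m + 1 := ⟨c + b - 1, by omega⟩
  choose p hp1 hp2 hp3 using fun d => exists_poly_sum_truncated (2 * c + 2 * b + 5)
    (fun g : Fin (d + 1) → ℕ => (goodWords c b d g).ncard)
    (fun g => ncard_goodWords_min (by omega) g)
  rw [hm, Nat.add_sub_cancel]
  refine ⟨∑ d ∈ Finset.range (m + 1), p d, ?_, ?_, ?_⟩
  · have h := (Filter.eventually_all_finset (Finset.range (m + 1))).2 fun d _ => hp1 d
    filter_upwards [h] with n hn
    rw [ncard_Av_eq, ncard_words_eq_sum (by omega), hm, eval_finsetSum, Nat.cast_sum]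
    exact Finset.sum_congr rfl hn
  · refine natDegree_sum_le_of_forall_le _ _ fun d hd => (hp2 d).trans ?_
    have := Finset.mem_range.1 hd
    omega
  -- Words with largest letter `d < m` contribute only degree at most `d`.
  · rw [finsetSum_coeff, Finset.sum_eq_single_of_mem m (by simp), hp3]
    · congr 2
      have h1 := ncard_goodWords_eq_catalan hcb (show c + b + 1 ≤ 2 * c + 2 * b + 5 by omega)
      rw [show c + b - 1 = m by omega] at h1
      rw [← h1]
    · intro d hd hne
      have := Finset.mem_range.1 hd
      exact coeff_eq_zero_of_natDegree_lt ((hp2 d).trans_lt (by omega))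

end PermPattern

theorem mainTheorem5 (a b : ℕ) (ha : 1 ≤ a) (hab : 3 ≤ a + b) :
    (∃ p : Polynomial ℚ, PermPattern.EventuallyCounts p
      (PermPattern.partialShuffle a b ∪ {PermPattern.decreasing 3})) ∧
    ∀ p : Polynomial ℚ, PermPattern.EventuallyCounts p
        (PermPattern.partialShuffle a b ∪ {PermPattern.decreasing 3}) →
      PermPattern.HasLeadingTerm p (catalan (a + b - 2) : ℚ) (a + b - 2) := by
  obtain ⟨c, rfl⟩ : ∃ c, a = c + 1 := ⟨a - 1, by omega⟩
  obtain ⟨p, hp, hdeg, hcoeff⟩ := PermPattern.exists_poly_ncard_Av (c := c) (b := b) (by omega)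
  have e : c + 1 + b - 2 = c + b - 1 := by omega
  refine ⟨⟨p, hp⟩, fun q hq => ?_⟩
  -- Both polynomials agree at all large integers, so the leading term is that of `p`.
  have hpq : q = p := by
    refine Polynomial.eq_of_infinite_eval_eq q p ?_
    obtain ⟨N, hN⟩ := Filter.eventually_atTop.1 (hp.and hq)
    refine (Set.infinite_range_of_injective (f := fun n : ℕ => ((N + n : ℕ) : ℚ)) ?_).mono ?_
    · intro x y hxy
      simpa using hxy
    · rintro _ ⟨n, rfl⟩
      have := hN (N + n) (by omega)
      exact this.2.symm.trans this.1
  rw [hpq, e]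
  refine ⟨?_, PermPattern.degree_sub_binomPoly_lt hdeg hcoeff⟩
  rw [Nat.cast_ne_zero, catalan_eq_centralBinom_div]
  have h1 := Nat.succ_dvd_centralBinom (c + b - 1)
  have h2 := Nat.centralBinom_pos (c + b - 1)
  exact (Nat.div_pos (Nat.le_of_dvd h2 h1) (by omega)).ne'
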